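/- Let $D\subseteq\mathbb{R}$ be an interval that is a neighbourhood of $0$, and let $\alpha,\beta,\gamma:D\to\mathbb{R}$ be a \emph{standard system of continuous real functions}, that is: $\alpha,\beta,\gamma$ are continuous on $D$; $\alpha(x)<\beta(x)<\gamma(x)$ for all $x\in D$; and every straight line of $\mathbb{R}^2$ through a point of the graph of any one of the three functions intersects each of the other two graphs in at most one point. Denote the graphs by $\overline\alpha,\overline\beta,\overline\gamma\subset\mathbb{R}^2$. Assume that collinearity between the three graphs is described by a group operation, that is: there are an Abelian topological group $(\mathcal{A},\oplus)$ and maps $f_1:\overline\alpha\to\mathcal{A}$, $f_2:\overline\beta\to\mathcal{A}$, $f_3:\overline\gamma\to\mathcal{A}$, each a homeomorphism onto its image, such that three distinct points $P_1\in\overline\alpha$, $P_2\in\overline\beta$, $P_3\in\overline\gamma$ are collinear if and only if $$f_1(P_1)\oplus f_2(P_2)\oplus f_3(P_3)=0 .$$ Then $\overline\alpha\cup\overline\beta\cup\overline\gamma$ is contained in a (possibly reducible) cubic curve, i.e. in the zero set of a real polynomial in two variables of total degree $3$. -/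

import Mathlib

open Set Topology

/-- A straight line of the real plane `ℝ × ℝ` (vertical lines included). -/
def IsStraightLine (L : AffineSubspace ℝ (ℝ × ℝ)) : Prop :=
  Module.finrank ℝ L.direction = 1

/-- Every straight line through a point of `Γ` intersects `Δ` in at most one point. -/
def LinesThroughMeetAtMostOnce (Γ Δ : Set (ℝ × ℝ)) : Prop :=
  ∀ L : AffineSubspace ℝ (ℝ × ℝ), IsStraightLine L →
    ((L : Set (ℝ × ℝ)) ∩ Γ).Nonempty → ((L : Set (ℝ × ℝ)) ∩ Δ).Subsingleton

/-- `α`, `β`, `γ` form a standard system of continuous real functions on the interval `D`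
(a connected neighbourhood of `0`; it may be unbounded and need not be open).
Only the values of the functions on `D` matter. The graphs are the sets `D.graphOn α`, etc. -/
structure IsStandardSystem (D : Set ℝ) (α β γ : ℝ → ℝ) : Prop where
  mem_nhds : D ∈ 𝓝 (0 : ℝ)
  ordConnected : D.OrdConnected
  continuousOn_α : ContinuousOn α D
  continuousOn_β : ContinuousOn β D
  continuousOn_γ : ContinuousOn γ D
  α_lt_β : ∀ x ∈ D, α x < β x
  β_lt_γ : ∀ x ∈ D, β x < γ x
  lines_α_β : LinesThroughMeetAtMostOnce (D.graphOn α) (D.graphOn β)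
  lines_α_γ : LinesThroughMeetAtMostOnce (D.graphOn α) (D.graphOn γ)
  lines_β_α : LinesThroughMeetAtMostOnce (D.graphOn β) (D.graphOn α)
  lines_β_γ : LinesThroughMeetAtMostOnce (D.graphOn β) (D.graphOn γ)
  lines_γ_α : LinesThroughMeetAtMostOnce (D.graphOn γ) (D.graphOn α)
  lines_γ_β : LinesThroughMeetAtMostOnce (D.graphOn γ) (D.graphOn β)

/-- Collinearity between the plane curves `Γ₁`, `Γ₂`, `Γ₃` is described by the operation of the
Abelian topological group `G`: there are maps `fᵢ : Γᵢ → G`, homeomorphisms onto their images,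
such that distinct points `Pᵢ ∈ Γᵢ` are collinear iff `f₁ P₁ + f₂ P₂ + f₃ P₃ = 0`. -/
def CollinearityDescribedBy (Γ₁ Γ₂ Γ₃ : Set (ℝ × ℝ))
    (G : Type*) [AddCommGroup G] [TopologicalSpace G] : Prop :=
  ∃ (f₁ : Γ₁ → G) (f₂ : Γ₂ → G) (f₃ : Γ₃ → G),
    IsEmbedding f₁ ∧ IsEmbedding f₂ ∧ IsEmbedding f₃ ∧
    ∀ (P₁ : Γ₁) (P₂ : Γ₂) (P₃ : Γ₃),
      (P₁ : ℝ × ℝ) ≠ P₂ → (P₁ : ℝ × ℝ) ≠ P₃ → (P₂ : ℝ × ℝ) ≠ P₃ →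
      (Collinear ℝ {(P₁ : ℝ × ℝ), (P₂ : ℝ × ℝ), (P₃ : ℝ × ℝ)} ↔ f₁ P₁ + f₂ P₂ + f₃ P₃ = 0)

/-- A (possibly reducible) cubic curve of the real plane: the set of real zeros of a real
polynomial in two variables of total degree exactly `3`. -/
def IsCubicCurve (C : Set (ℝ × ℝ)) : Prop :=
  ∃ p : MvPolynomial (Fin 2) ℝ, p.totalDegree = 3 ∧
    C = {P : ℝ × ℝ | MvPolynomial.eval ![P.1, P.2] p = 0}

/-! Over an interior abscissa `x₀` of `D`, the line through a point of `α` and a point of `γ` meets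
`β` at an abscissa between theirs. Collinearity therefore turns a small arc of `β`, embedded in the
group, into a one-dimensional local abelian group. Continuity and cancellation make its addition
strictly monotone, so elements can be halved repeatedly, which gives a dyadic one-parameter
subgroup. Projecting `α` and `γ` to `β` from the points of `γ` and `α` over `x₀` carries it to all
three curves. At each level `n` this yields points `A i`, `B j`, `C k` with indices up to `2 ^ n`,
collinear whenever `i + j + k = 0`, and filling arcs around `x₀` more and more densely.

A cubic is rigid on such a grid. Nine points whose indices form a square with rows and columns of
sum zero satisfy `cayley_bacharach`, so eight zeros force the ninth. Hence nine well-chosen zeros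
fill a window of radius 3 (`zeroOn_three`), and a window fills almost the whole grid
(`zeroOn_of_window`). Cubics form a space of dimension ten, so each level has a nonzero solution;
the solution spaces decrease with `n` and stabilise, and one cubic serves all levels. By density it
contains the curves near `x₀` (`AreCollinearScales.exists_cubic`).

The same rigidity makes the conclusion global. If a cubic contains the curves on one side of `x₀`, a
fine grid around `x₀` has a full window on that side, so the cubic contains them on both sides
(`AreCollinearScales.eventually_of_side`). Continuous induction from `0` covers the interior of `D`,
and continuity adds the endpoints. -/

/-! ### Polynomial functions of bounded degree and division by a linear form. -/

/-- Real polynomial functions on the plane of total degree at most `n`. -/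
def IsPolyLE : ℕ → (ℝ × ℝ → ℝ) → Prop
  | 0, f => ∃ c, ∀ P, f P = c
  | n + 1, f => ∃ c g h, IsPolyLE n g ∧ IsPolyLE n h ∧ ∀ P, f P = c + P.1 * g P + P.2 * h P

namespace IsPolyLE

theorem congr {n : ℕ} {f g : ℝ × ℝ → ℝ} (hf : IsPolyLE n f) (h : ∀ P, g P = f P) :
    IsPolyLE n g := by
  rwa [show g = f from funext h]

theorem const (n : ℕ) (c : ℝ) : IsPolyLE n (fun _ => c) := by
  induction n generalizing c with
  | zero => exact ⟨c, fun _ => rfl⟩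
  | succ n ih => exact ⟨c, _, _, ih 0, ih 0, fun P => by simp⟩

theorem add {n : ℕ} {f g : ℝ × ℝ → ℝ} (hf : IsPolyLE n f) (hg : IsPolyLE n g) :
    IsPolyLE n (fun P => f P + g P) := by
  induction n generalizing f g with
  | zero =>
    obtain ⟨c, hc⟩ := hf
    obtain ⟨d, hd⟩ := hg
    exact ⟨c + d, fun P => by simp only [hc, hd]⟩
  | succ n ih =>
    obtain ⟨c, f₁, f₂, h₁, h₂, hf⟩ := hf
    obtain ⟨d, g₁, g₂, k₁, k₂, hg⟩ := hg
    exact ⟨c + d, _, _, ih h₁ k₁, ih h₂ k₂, fun P => by simp only [hf, hg]; ring⟩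

theorem const_mul {n : ℕ} {f : ℝ × ℝ → ℝ} (c : ℝ) (hf : IsPolyLE n f) :
    IsPolyLE n (fun P => c * f P) := by
  induction n generalizing f with
  | zero =>
    obtain ⟨d, hd⟩ := hf
    exact ⟨c * d, fun P => by simp only [hd]⟩
  | succ n ih =>
    obtain ⟨d, f₁, f₂, h₁, h₂, hf⟩ := hf
    exact ⟨c * d, _, _, ih h₁, ih h₂, fun P => by simp only [hf]; ring⟩

theorem succ {n : ℕ} {f : ℝ × ℝ → ℝ} (hf : IsPolyLE n f) : IsPolyLE (n + 1) f := by
  induction n generalizing f with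
  | zero =>
    obtain ⟨c, hc⟩ := hf
    exact (const 1 c).congr hc
  | succ n ih =>
    obtain ⟨d, f₁, f₂, h₁, h₂, hf⟩ := hf
    exact ⟨d, _, _, ih h₁, ih h₂, hf⟩

theorem fst_mul {n : ℕ} {f : ℝ × ℝ → ℝ} (hf : IsPolyLE n f) :
    IsPolyLE (n + 1) (fun P => P.1 * f P) :=
  ⟨0, _, _, hf, const n 0, fun P => by ring⟩

theorem snd_mul {n : ℕ} {f : ℝ × ℝ → ℝ} (hf : IsPolyLE n f) :
    IsPolyLE (n + 1) (fun P => P.2 * f P) :=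
  ⟨0, _, _, const n 0, hf, fun P => by ring⟩

theorem affine_mul {n : ℕ} {f : ℝ × ℝ → ℝ} (hf : IsPolyLE n f) (a b c : ℝ) :
    IsPolyLE (n + 1) (fun P => (a * P.1 + b * P.2 + c) * f P) :=
  (((hf.fst_mul.const_mul a).add (hf.snd_mul.const_mul b)).add (hf.succ.const_mul c)).congr
    fun P => by ring

open Polynomial in
theorem eval_affine {n : ℕ} (r : ℝ[X]) (hr : r.natDegree ≤ n) (a b c : ℝ) :
    IsPolyLE n (fun P => r.eval (a * P.1 + b * P.2 + c)) := by
  induction n generalizing r with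
  | zero =>
    rw [Polynomial.eq_C_of_natDegree_le_zero hr]
    exact (const 0 _).congr fun P => by rw [eval_C]
  | succ n ih =>
    have h := ih r.divX (by rw [natDegree_divX_eq_natDegree_tsub_one]; omega)
    refine ((h.affine_mul a b c).add (const _ (r.coeff 0))).congr fun P => ?_
    have := congrArg (eval (a * P.1 + b * P.2 + c)) (divX_mul_X_add r)
    simp only [eval_add, eval_mul, eval_X, eval_C] at this
    linarith

open Polynomial in
/-- Division with remainder by the affine form `v.2 * (x - Q.1) - v.1 * (y - Q.2)`. -/
theorem exists_div {n : ℕ} {f : ℝ × ℝ → ℝ} (hf : IsPolyLE (n + 1) f) (Q v : ℝ × ℝ)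
    (hv : v.1 ^ 2 + v.2 ^ 2 = 1) :
    ∃ (g : ℝ × ℝ → ℝ) (r : ℝ[X]), IsPolyLE n g ∧ r.natDegree ≤ n + 1 ∧
      ∀ P, f P = (v.2 * (P.1 - Q.1) - v.1 * (P.2 - Q.2)) * g P
        + r.eval (v.1 * (P.1 - Q.1) + v.2 * (P.2 - Q.2)) := by
  -- As `v` is a unit vector, `P` is recovered from its coordinates along `v` and its normal.
  -- Substituting for `x` and `y` splits off a multiple of the normal coordinate and leaves a
  -- polynomial in the other one.
  have hx : ∀ P : ℝ × ℝ, P.1 = Q.1 + v.1 * (v.1 * (P.1 - Q.1) + v.2 * (P.2 - Q.2))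
      + v.2 * (v.2 * (P.1 - Q.1) - v.1 * (P.2 - Q.2)) := fun P => by
    linear_combination (Q.1 - P.1) * hv
  have hy : ∀ P : ℝ × ℝ, P.2 = Q.2 + v.2 * (v.1 * (P.1 - Q.1) + v.2 * (P.2 - Q.2))
      - v.1 * (v.2 * (P.1 - Q.1) - v.1 * (P.2 - Q.2)) := fun P => by
    linear_combination (Q.2 - P.2) * hv
  have hrem : ∀ {m : ℕ} (r : ℝ[X]), r.natDegree ≤ m →
      IsPolyLE m (fun P => r.eval (v.1 * (P.1 - Q.1) + v.2 * (P.2 - Q.2))) := fun r hr =>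
    (eval_affine r hr v.1 v.2 (-(v.1 * Q.1) - v.2 * Q.2)).congr fun P => by congr 1; ring
  have hdeg : ∀ {m : ℕ} (r s : ℝ[X]) (a b c d e : ℝ), r.natDegree ≤ m → s.natDegree ≤ m →
      (C c + (C a + C b * X) * r + (C d + C e * X) * s).natDegree ≤ m + 1 := by
    intro m r s a b c d e hr hs
    compute_degree
    omega
  induction n generalizing f with
  | zero =>
    obtain ⟨c, f₁, f₂, ⟨a, ha⟩, ⟨b, hb⟩, hf⟩ := hf
    refine ⟨fun _ => v.2 * a - v.1 * b, C c + (C Q.1 + C v.1 * X) * C a + (C Q.2 + C v.2 * X) * C b,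
      const 0 _, hdeg _ _ _ _ _ _ _ (by simp) (by simp), fun P => ?_⟩
    rw [hf, ha, hb]
    simp only [eval_add, eval_mul, eval_C, eval_X]
    linear_combination a * hx P + b * hy P
  | succ n ih =>
    obtain ⟨c, f₁, f₂, h₁, h₂, hf⟩ := hf
    obtain ⟨g₁, r₁, hg₁, hr₁, h₁⟩ := ih h₁
    obtain ⟨g₂, r₂, hg₂, hr₂, h₂⟩ := ih h₂
    refine ⟨_, C c + (C Q.1 + C v.1 * X) * r₁ + (C Q.2 + C v.2 * X) * r₂,
      ((hg₁.fst_mul.add hg₂.snd_mul).add ((hrem r₁ hr₁).const_mul v.2)).add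
        ((hrem r₂ hr₂).const_mul (-v.1)), hdeg _ _ _ _ _ _ _ hr₁ hr₂, fun P => ?_⟩
    rw [hf, h₁, h₂]
    simp only [eval_add, eval_mul, eval_C, eval_X]
    linear_combination
      (r₁.eval (v.1 * (P.1 - Q.1) + v.2 * (P.2 - Q.2))) * hx P
      + (r₂.eval (v.1 * (P.1 - Q.1) + v.2 * (P.2 - Q.2))) * hy P

end IsPolyLE

/-! ### Signed areas and the Cayley–Bacharach theorem. -/

/-- Twice the signed area of the triangle `P Q R`. -/
def det3 (P Q R : ℝ × ℝ) : ℝ :=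
  (Q.1 - P.1) * (R.2 - P.2) - (Q.2 - P.2) * (R.1 - P.1)

/-- A polynomial function of degree at most `n + 1` with more than `n + 1` zeros on a line
is divisible by the equation of the line. -/
theorem IsPolyLE.exists_eq_det3_mul {n : ℕ} {f : ℝ × ℝ → ℝ} (hf : IsPolyLE (n + 1) f)
    {P Q : ℝ × ℝ} (hPQ : P ≠ Q) (S : Finset (ℝ × ℝ)) (hcard : n + 1 < S.card)
    (hS : ∀ R ∈ S, det3 P Q R = 0 ∧ f R = 0) :
    ∃ g, IsPolyLE n g ∧ ∀ R, f R = det3 P Q R * g R := by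
  set d : ℝ := Real.sqrt ((Q.1 - P.1) ^ 2 + (Q.2 - P.2) ^ 2) with hd
  have hpos : 0 < (Q.1 - P.1) ^ 2 + (Q.2 - P.2) ^ 2 := by
    by_contra h
    apply hPQ
    have h1 : (Q.1 - P.1) ^ 2 = 0 := by nlinarith [sq_nonneg (Q.1 - P.1), sq_nonneg (Q.2 - P.2)]
    have h2 : (Q.2 - P.2) ^ 2 = 0 := by nlinarith [sq_nonneg (Q.1 - P.1), sq_nonneg (Q.2 - P.2)]
    rw [sq_eq_zero_iff] at h1 h2
    exact Prod.ext (by linarith) (by linarith)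
  have hd0 : d ≠ 0 := (Real.sqrt_pos.2 hpos).ne'
  have hdsq : d ^ 2 = (Q.1 - P.1) ^ 2 + (Q.2 - P.2) ^ 2 := Real.sq_sqrt hpos.le
  set v : ℝ × ℝ := ((Q.1 - P.1) / d, (Q.2 - P.2) / d) with hv
  have hv1 : v.1 ^ 2 + v.2 ^ 2 = 1 := by
    simp only [hv]; field_simp; linarith
  obtain ⟨g, r, hg, hr, hfg⟩ := hf.exists_div P v hv1
  have hline : ∀ R, v.2 * (R.1 - P.1) - v.1 * (R.2 - P.2) = -(1 / d) * det3 P Q R := fun R => by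
    simp only [hv, det3]; field_simp; ring
  -- The remainder is a polynomial in the position along the line, which separates the points of
  -- `S`; it has more roots than its degree allows.
  have hr0 : r = 0 := by
    refine Polynomial.eq_zero_of_natDegree_lt_card_of_eval_eq_zero' r
      (S.image fun R => v.1 * (R.1 - P.1) + v.2 * (R.2 - P.2)) ?_ ?_
    · intro t ht
      obtain ⟨R, hR, rfl⟩ := Finset.mem_image.1 ht
      have := hfg R
      rw [hline, (hS R hR).1, (hS R hR).2] at this
      linarith
    · rw [Finset.card_image_of_injOn]
      · omega
      · intro R hR R' hR' h
        have e1 := hline R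
        have e2 := hline R'
        rw [(hS R hR).1] at e1
        rw [(hS R' hR').1] at e2
        simp only at h
        refine Prod.ext ?_ ?_
        · linear_combination v.1 * h + v.2 * e1 - v.2 * e2 - (R.1 - R'.1) * hv1
        · linear_combination v.2 * h - v.1 * e1 + v.1 * e2 - (R.2 - R'.2) * hv1
  refine ⟨_, hg.const_mul (-(1 / d)), fun R => ?_⟩
  rw [hfg, hline, hr0, Polynomial.eval_zero]
  ring

theorem det3_affine (P Q : ℝ × ℝ) : ∃ a b c : ℝ, ∀ R, det3 P Q R = a * R.1 + b * R.2 + c :=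
  ⟨-(Q.2 - P.2), Q.1 - P.1, (Q.2 - P.2) * P.1 - (Q.1 - P.1) * P.2, fun R => by
    simp only [det3]; ring⟩

theorem IsPolyLE.det3_mul {n : ℕ} {f : ℝ × ℝ → ℝ} (hf : IsPolyLE n f) (P Q : ℝ × ℝ) :
    IsPolyLE (n + 1) (fun R => det3 P Q R * f R) := by
  obtain ⟨a, b, c, h⟩ := det3_affine P Q
  exact (hf.affine_mul a b c).congr fun R => by simp only [h]

theorem det3_self_left (P Q : ℝ × ℝ) : det3 P Q P = 0 := by simp only [det3]; ring

theorem det3_self_right (P Q : ℝ × ℝ) : det3 P Q Q = 0 := by simp only [det3]; ring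

/-- **Cayley–Bacharach** for a `3 × 3` grid of points with collinear rows and columns: a cubic
through eight of the points passes through the ninth. -/
theorem cayley_bacharach {f : ℝ × ℝ → ℝ} (hf : IsPolyLE 3 f)
    {P₁₁ P₁₂ P₁₃ P₂₁ P₂₂ P₂₃ P₃₁ P₃₂ P₃₃ : ℝ × ℝ}
    (r₁ : det3 P₁₂ P₁₃ P₁₁ = 0) (r₂ : det3 P₂₁ P₂₂ P₂₃ = 0) (r₃ : det3 P₃₁ P₃₂ P₃₃ = 0)
    (c₁ : det3 P₂₁ P₃₁ P₁₁ = 0) (c₂ : det3 P₂₂ P₃₂ P₁₂ = 0) (c₃ : det3 P₂₃ P₃₃ P₁₃ = 0)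
    (d₁ : P₁₂ ≠ P₁₃) (d₂ : P₂₁ ≠ P₂₂) (d₂' : P₂₁ ≠ P₂₃) (d₂'' : P₂₂ ≠ P₂₃)
    (d₃ : P₃₁ ≠ P₃₂) (d₃' : P₃₁ ≠ P₃₃) (d₃'' : P₃₂ ≠ P₃₃)
    (n₂₁ : det3 P₃₁ P₃₂ P₂₁ ≠ 0) (n₂₂ : det3 P₃₁ P₃₂ P₂₂ ≠ 0) (n₂₃ : det3 P₃₁ P₃₂ P₂₃ ≠ 0)
    (n₁₂ : det3 P₃₁ P₃₂ P₁₂ ≠ 0) (n₁₃ : det3 P₃₁ P₃₂ P₁₃ ≠ 0)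
    (m₁₂ : det3 P₂₁ P₂₂ P₁₂ ≠ 0) (m₁₃ : det3 P₂₁ P₂₂ P₁₃ ≠ 0)
    (f₁₂ : f P₁₂ = 0) (f₁₃ : f P₁₃ = 0) (f₂₁ : f P₂₁ = 0) (f₂₂ : f P₂₂ = 0) (f₂₃ : f P₂₃ = 0)
    (f₃₁ : f P₃₁ = 0) (f₃₂ : f P₃₂ = 0) (f₃₃ : f P₃₃ = 0) : f P₁₁ = 0 := by
  set M : ℝ × ℝ → ℝ := fun R => det3 P₂₁ P₃₁ R * (det3 P₂₂ P₃₂ R * (det3 P₂₃ P₃₃ R * 1)) with hM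
  have hMp : IsPolyLE 3 M :=
    (((IsPolyLE.const 0 1).det3_mul P₂₃ P₃₃).det3_mul P₂₂ P₃₂).det3_mul P₂₁ P₃₁
  -- `Q` will be a fourth point of the third line; the excluded parameters are those that could make
  -- it one of the other three. A zero denominator merely excludes `0` once more.
  obtain ⟨t, ht⟩ : ∃ t : ℝ, t ∉ ({0, 1, (P₃₃.1 - P₃₁.1) / (P₃₂.1 - P₃₁.1),
      (P₃₃.2 - P₃₁.2) / (P₃₂.2 - P₃₁.2)} : Finset ℝ) := Infinite.exists_notMem_finset _
  simp only [Finset.mem_insert, Finset.mem_singleton, not_or] at ht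
  obtain ⟨t0, t1, t2, t3⟩ := ht
  set Q : ℝ × ℝ := (P₃₁.1 + t * (P₃₂.1 - P₃₁.1), P₃₁.2 + t * (P₃₂.2 - P₃₁.2)) with hQ
  have hQl : det3 P₃₁ P₃₂ Q = 0 := by simp only [det3, hQ]; ring
  have hdir : P₃₂.1 - P₃₁.1 ≠ 0 ∨ P₃₂.2 - P₃₁.2 ≠ 0 := by
    by_contra! h
    exact d₃ (Prod.ext (by linarith [h.1]) (by linarith [h.2]))
  have q1 : P₃₁ ≠ Q := by
    intro h
    have e1 : t * (P₃₂.1 - P₃₁.1) = 0 := by have := congrArg Prod.fst h; simp only [hQ] at this; linarith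
    have e2 : t * (P₃₂.2 - P₃₁.2) = 0 := by have := congrArg Prod.snd h; simp only [hQ] at this; linarith
    rcases hdir with h | h
    · exact (mul_ne_zero t0 h) e1
    · exact (mul_ne_zero t0 h) e2
  have q2 : P₃₂ ≠ Q := by
    intro h
    have e1 : (t - 1) * (P₃₂.1 - P₃₁.1) = 0 := by
      have := congrArg Prod.fst h; simp only [hQ] at this; linarith
    have e2 : (t - 1) * (P₃₂.2 - P₃₁.2) = 0 := by
      have := congrArg Prod.snd h; simp only [hQ] at this; linarith
    rcases hdir with h | h
    · exact (mul_ne_zero (sub_ne_zero.2 t1) h) e1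
    · exact (mul_ne_zero (sub_ne_zero.2 t1) h) e2
  have q3 : P₃₃ ≠ Q := by
    intro h
    rcases hdir with h' | h'
    · apply t2; rw [eq_div_iff h']
      have := congrArg Prod.fst h; simp only [hQ] at this; linarith
    · apply t3; rw [eq_div_iff h']
      have := congrArg Prod.snd h; simp only [hQ] at this; linarith
  clear_value Q
  clear hQ t0 t1 t2 t3
  -- a line through a point `R` off the third line meets it only once
  have hmeet : ∀ R S : ℝ × ℝ, det3 P₃₁ P₃₂ R ≠ 0 → det3 P₃₁ P₃₂ S = 0 → S ≠ Q →
      det3 R S Q ≠ 0 := by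
    intro R S hR hS hSQ h
    simp only [det3] at hR hS h hQl
    apply hSQ
    set x := P₃₂.1 - P₃₁.1
    set y := P₃₂.2 - P₃₁.2
    have hperp : x * (Q.2 - S.2) - y * (Q.1 - S.1) = 0 := by linear_combination hQl - hS
    have k1 : (x * (R.2 - P₃₁.2) - y * (R.1 - P₃₁.1)) * (Q.1 - S.1) = 0 := by
      linear_combination (Q.1 - S.1) * hS + x * h + (R.1 - S.1) * hperp
    have k2 : (x * (R.2 - P₃₁.2) - y * (R.1 - P₃₁.1)) * (Q.2 - S.2) = 0 := by
      linear_combination (Q.2 - S.2) * hS + y * h + (R.2 - S.2) * hperp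
    have k1 := (mul_eq_zero.1 k1).resolve_left hR
    have k2 := (mul_eq_zero.1 k2).resolve_left hR
    exact Prod.ext (by linarith) (by linarith)
  have hMQ : M Q ≠ 0 := by
    have h1 := hmeet _ _ n₂₁ (det3_self_left _ _) q1
    have h2 := hmeet _ _ n₂₂ (det3_self_right _ _) q2
    have h3 := hmeet _ _ n₂₃ r₃ q3
    simp only [hM]
    exact mul_ne_zero h1 (mul_ne_zero h2 (mul_ne_zero h3 one_ne_zero))
  -- `M` is the product of the three columns and is nonzero at `Q`, so subtracting a multiple of it
  -- creates a fourth zero on the third row without losing any. The rows then split off one by one,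
  -- with 4, 3 and 2 zeros against degrees 3, 2 and 1, and the first row passes through `P₁₁`.
  set u : ℝ × ℝ → ℝ := fun R => f R + -(f Q / M Q) * M R with hu
  have hup : IsPolyLE 3 u := hf.add (hMp.const_mul _)
  have huM : ∀ R, f R = 0 → M R = 0 → u R = 0 := fun R h1 h2 => by simp only [hu, h1, h2]; ring
  have M1 : ∀ R, det3 P₂₁ P₃₁ R = 0 → M R = 0 := fun R h => by simp only [hM, h]; ring
  have M2 : ∀ R, det3 P₂₂ P₃₂ R = 0 → M R = 0 := fun R h => by simp only [hM, h]; ring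
  have M3 : ∀ R, det3 P₂₃ P₃₃ R = 0 → M R = 0 := fun R h => by simp only [hM, h]; ring
  have u₁₂ := huM _ f₁₂ (M2 _ c₂)
  have u₁₃ := huM _ f₁₃ (M3 _ c₃)
  have u₂₁ := huM _ f₂₁ (M1 _ (det3_self_left _ _))
  have u₂₂ := huM _ f₂₂ (M2 _ (det3_self_left _ _))
  have u₂₃ := huM _ f₂₃ (M3 _ (det3_self_left _ _))
  have u₃₁ := huM _ f₃₁ (M1 _ (det3_self_right _ _))
  have u₃₂ := huM _ f₃₂ (M2 _ (det3_self_right _ _))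
  have u₃₃ := huM _ f₃₃ (M3 _ (det3_self_right _ _))
  have uQ : u Q = 0 := by simp only [hu]; field_simp; ring
  obtain ⟨g, hg, hug⟩ := hup.exists_eq_det3_mul d₃ {P₃₁, P₃₂, P₃₃, Q} (by
      rw [Finset.card_insert_of_notMem, Finset.card_insert_of_notMem,
        Finset.card_insert_of_notMem, Finset.card_singleton] <;> simp [*]) (by
      simp only [Finset.mem_insert, Finset.mem_singleton]
      rintro R (rfl | rfl | rfl | rfl)
      · exact ⟨det3_self_left _ _, u₃₁⟩
      · exact ⟨det3_self_right _ _, u₃₂⟩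
      · exact ⟨r₃, u₃₃⟩
      · exact ⟨hQl, uQ⟩)
  have hg0 : ∀ R, u R = 0 → det3 P₃₁ P₃₂ R ≠ 0 → g R = 0 := fun R h1 h2 => by
    rw [hug] at h1
    exact (mul_eq_zero.1 h1).resolve_left h2
  obtain ⟨k, hk, hgk⟩ := hg.exists_eq_det3_mul d₂ {P₂₁, P₂₂, P₂₃} (by
      rw [Finset.card_insert_of_notMem, Finset.card_insert_of_notMem,
        Finset.card_singleton] <;> simp [*]) (by
      simp only [Finset.mem_insert, Finset.mem_singleton]
      rintro R (rfl | rfl | rfl)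
      · exact ⟨det3_self_left _ _, hg0 _ u₂₁ n₂₁⟩
      · exact ⟨det3_self_right _ _, hg0 _ u₂₂ n₂₂⟩
      · exact ⟨r₂, hg0 _ u₂₃ n₂₃⟩)
  have hk0 : ∀ R, u R = 0 → det3 P₃₁ P₃₂ R ≠ 0 → det3 P₂₁ P₂₂ R ≠ 0 → k R = 0 := fun R h1 h2 h3 => by
    have := hg0 R h1 h2
    rw [hgk] at this
    exact (mul_eq_zero.1 this).resolve_left h3
  obtain ⟨l, hl, hkl⟩ := hk.exists_eq_det3_mul d₁ {P₁₂, P₁₃} (by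
      rw [Finset.card_pair d₁]; norm_num) (by
      simp only [Finset.mem_insert, Finset.mem_singleton]
      rintro R (rfl | rfl)
      · exact ⟨det3_self_left _ _, hk0 _ u₁₂ n₁₂ m₁₂⟩
      · exact ⟨det3_self_right _ _, hk0 _ u₁₃ n₁₃ m₁₃⟩)
  have hu0 : u P₁₁ = 0 := by rw [hug, hgk, hkl, r₁]; ring
  simp only [hu, M1 _ c₁] at hu0
  linarith

theorem det3_rotate (P Q R : ℝ × ℝ) : det3 P Q R = det3 Q R P := by
  simp only [det3]; ring

/-- Two points of the line `P Q` are collinear with `P`, and with `Q`. -/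
theorem det3_of_line {P Q R S : ℝ × ℝ} (h : P ≠ Q) (hR : det3 P Q R = 0) (hS : det3 P Q S = 0) :
    det3 P R S = 0 ∧ det3 Q R S = 0 := by
  have hdir : Q.1 - P.1 ≠ 0 ∨ Q.2 - P.2 ≠ 0 := by
    by_contra! h'
    exact h (Prod.ext (by linarith [h'.1]) (by linarith [h'.2]))
  simp only [det3] at *
  set x := Q.1 - P.1 with hx
  set y := Q.2 - P.2 with hy
  have key : (R.1 - P.1) * (S.2 - P.2) - (R.2 - P.2) * (S.1 - P.1) = 0 := by
    rcases hdir with h0 | h0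
    · refine (mul_eq_zero.1 (?_ : x * _ = 0)).resolve_left h0
      linear_combination (R.1 - P.1) * hS - (S.1 - P.1) * hR
    · refine (mul_eq_zero.1 (?_ : y * _ = 0)).resolve_left h0
      linear_combination (R.2 - P.2) * hS - (S.2 - P.2) * hR
  refine ⟨key, ?_⟩
  linear_combination key + hR - hS + (S.1 - R.1) * hy - (S.2 - R.2) * hx

/-! ### Propagation of the zeros of a cubic along a collinear grid. -/

/-- Three finite sequences of points, indexed by the integers of absolute value at most `N`, such
that points with indices of sum zero are collinear, in a non-degenerate way. -/
structure CollinearGrid (N : ℤ) (A B C : ℤ → ℝ × ℝ) : Prop where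
  det_eq : ∀ i j k, |i| ≤ N → |j| ≤ N → |k| ≤ N → i + j + k = 0 → det3 (A i) (B j) (C k) = 0
  ne_AB : ∀ i j, |i| ≤ N → |j| ≤ N → A i ≠ B j
  ne_BC : ∀ i j, |i| ≤ N → |j| ≤ N → B i ≠ C j
  ne_CA : ∀ i j, |i| ≤ N → |j| ≤ N → C i ≠ A j
  inj_A : ∀ i j k i', |i| ≤ N → |j| ≤ N → |k| ≤ N → |i'| ≤ N → i + j + k = 0 →
    det3 (A i') (B j) (C k) = 0 → i' = i
  inj_B : ∀ i j k j', |i| ≤ N → |j| ≤ N → |k| ≤ N → |j'| ≤ N → i + j + k = 0 →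
    det3 (A i) (B j') (C k) = 0 → j' = j
  inj_C : ∀ i j k k', |i| ≤ N → |j| ≤ N → |k| ≤ N → |k'| ≤ N → i + j + k = 0 →
    det3 (A i) (B j) (C k') = 0 → k' = k

namespace CollinearGrid

variable {N : ℤ} {A B C : ℤ → ℝ × ℝ} {f : ℝ × ℝ → ℝ}

theorem rotate (h : CollinearGrid N A B C) : CollinearGrid N B C A where
  det_eq j k i hj hk hi hs := by
    rw [← det3_rotate]; exact h.det_eq i j k hi hj hk (by omega)
  ne_AB := h.ne_BC
  ne_BC := h.ne_CA
  ne_CA := h.ne_AB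
  inj_A j k i j' hj hk hi hj' hs h0 :=
    h.inj_B i j k j' hi hj hk hj' (by omega) (by rw [det3_rotate]; exact h0)
  inj_B j k i k' hj hk hi hk' hs h0 :=
    h.inj_C i j k k' hi hj hk hk' (by omega) (by rw [det3_rotate]; exact h0)
  inj_C j k i i' hj hk hi hi' hs h0 :=
    h.inj_A i j k i' hi hj hk hi' (by omega) (by rw [det3_rotate]; exact h0)

/-- Cayley–Bacharach for the Latin square with rows `A a₁, B b₁, C c₁`; `B b₂, C c₂, A a₂`; `C c₃, A
a₃, B b₃`. The equations `rᵢ` make the rows collinear and the `sᵢ` the columns. Distinct indices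
suffice for non-degeneracy, since two points of a line determine the index of the third. -/
theorem zero_step (h : CollinearGrid N A B C) (hf : IsPolyLE 3 f)
    (a₁ b₁ c₁ b₂ c₂ a₂ c₃ a₃ b₃ : ℤ)
    (ha₁ : |a₁| ≤ N) (ha₂ : |a₂| ≤ N) (ha₃ : |a₃| ≤ N) (hb₁ : |b₁| ≤ N) (hb₂ : |b₂| ≤ N)
    (hb₃ : |b₃| ≤ N) (hc₁ : |c₁| ≤ N) (hc₂ : |c₂| ≤ N) (hc₃ : |c₃| ≤ N)
    (r₁ : a₁ + b₁ + c₁ = 0) (r₂ : a₂ + b₂ + c₂ = 0) (r₃ : a₃ + b₃ + c₃ = 0)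
    (s₁ : a₁ + b₂ + c₃ = 0) (s₂ : a₃ + b₁ + c₂ = 0) (s₃ : a₂ + b₃ + c₁ = 0)
    (dA : a₂ ≠ a₃) (dB : b₁ ≠ b₂) (dB' : b₁ ≠ b₃) (dB'' : b₂ ≠ b₃)
    (dC : c₁ ≠ c₂) (dC' : c₁ ≠ c₃) (dC'' : c₂ ≠ c₃)
    (fa₂ : f (A a₂) = 0) (fa₃ : f (A a₃) = 0) (fb₁ : f (B b₁) = 0) (fb₂ : f (B b₂) = 0)
    (fb₃ : f (B b₃) = 0) (fc₁ : f (C c₁) = 0) (fc₂ : f (C c₂) = 0) (fc₃ : f (C c₃) = 0) :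
    f (A a₁) = 0 := by
  have row₃ : det3 (C c₃) (A a₃) (B b₃) = 0 := by
    rw [det3_rotate]; exact h.det_eq _ _ _ ha₃ hb₃ hc₃ r₃
  have row₂ : det3 (B b₂) (C c₂) (A a₂) = 0 := by
    rw [← det3_rotate]; exact h.det_eq _ _ _ ha₂ hb₂ hc₂ r₂
  have onB : ∀ b, |b| ≤ N → b ≠ b₃ → det3 (C c₃) (A a₃) (B b) ≠ 0 := fun b hb hne h0 =>
    hne (h.inj_B a₃ b₃ c₃ b ha₃ hb₃ hc₃ hb r₃ (by rw [← det3_rotate]; exact h0))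
  have onC : ∀ c, |c| ≤ N → c ≠ c₃ → det3 (C c₃) (A a₃) (C c) ≠ 0 := fun c hc hne h0 =>
    hne (h.inj_C a₃ b₃ c₃ c ha₃ hb₃ hc₃ hc r₃ (det3_of_line (h.ne_CA _ _ hc₃ ha₃) row₃ h0).2)
  have onA : ∀ a, |a| ≤ N → a ≠ a₃ → det3 (C c₃) (A a₃) (A a) ≠ 0 := fun a ha hne h0 => by
    refine hne (h.inj_A a₃ b₃ c₃ a ha₃ hb₃ hc₃ ha r₃ ?_)
    have := (det3_of_line (h.ne_CA _ _ hc₃ ha₃) h0 row₃).1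
    rwa [det3_rotate] at this
  refine cayley_bacharach (P₁₁ := A a₁) (P₁₂ := B b₁) (P₁₃ := C c₁) (P₂₁ := B b₂) (P₂₂ := C c₂)
    (P₂₃ := A a₂) (P₃₁ := C c₃) (P₃₂ := A a₃) (P₃₃ := B b₃) hf ?_ row₂ row₃ ?_ ?_ ?_
    (h.ne_BC _ _ hb₁ hc₁) (h.ne_BC _ _ hb₂ hc₂) (h.ne_AB _ _ ha₂ hb₂).symm
    (h.ne_CA _ _ hc₂ ha₂) (h.ne_CA _ _ hc₃ ha₃) (h.ne_BC _ _ hb₃ hc₃).symm (h.ne_AB _ _ ha₃ hb₃)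
    (onB _ hb₂ dB'') (onC _ hc₂ dC'') (onA _ ha₂ dA) (onB _ hb₁ dB') (onC _ hc₁ dC') ?_ ?_
    fb₁ fc₁ fb₂ fc₂ fa₂ fc₃ fa₃ fb₃
  · rw [← det3_rotate]; exact h.det_eq _ _ _ ha₁ hb₁ hc₁ r₁
  · rw [← det3_rotate]; exact h.det_eq _ _ _ ha₁ hb₂ hc₃ s₁
  · rw [det3_rotate]; exact h.det_eq _ _ _ ha₃ hb₁ hc₂ s₂
  · exact h.det_eq _ _ _ ha₂ hb₃ hc₁ s₃
  · intro h0
    refine dB (h.inj_B a₂ b₂ c₂ b₁ ha₂ hb₂ hc₂ hb₁ r₂ ?_)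
    have := (det3_of_line (h.ne_BC _ _ hb₂ hc₂) row₂ h0).2
    rwa [det3_rotate] at this
  · intro h0
    refine dC (h.inj_C a₂ b₂ c₂ c₁ ha₂ hb₂ hc₂ hc₁ r₂ ?_)
    have := (det3_of_line (h.ne_BC _ _ hb₂ hc₂) h0 row₂).1
    rwa [det3_rotate, det3_rotate] at this

/-- `f` vanishes on the points of `A` with index at distance at most `m` from `s`. -/
def ZeroOn (f : ℝ × ℝ → ℝ) (A : ℤ → ℝ × ℝ) (s m : ℤ) : Prop :=
  ∀ i, |i - s| ≤ m → f (A i) = 0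

theorem zeroOn_succ (h : CollinearGrid N A B C) (hf : IsPolyLE 3 f) {s t w m : ℤ}
    (hs : s + t + w = 0) (hm : 3 ≤ m) (hsN : |s| + m + 1 ≤ N) (htN : |t| + m + 1 ≤ N)
    (hwN : |w| + m + 1 ≤ N) (hA : ZeroOn f A s m) (hB : ZeroOn f B t m) (hC : ZeroOn f C w m) :
    ZeroOn f A s (m + 1) := by
  intro i hi
  by_cases hi' : |i - s| ≤ m
  · exact hA i hi'
  have hcase : i = s + (m + 1) ∨ i = s - (m + 1) := by
    rcases abs_cases (i - s) with h | h <;> omega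
  have bd : ∀ x y : ℤ, |x| + m + 1 ≤ N → |y| ≤ m + 1 → |x + y| ≤ N := fun x y h1 h2 =>
    (abs_add_le x y).trans (by omega)
  have ab : ∀ y : ℤ, -(m + 1) ≤ y → y ≤ m + 1 → |y| ≤ m + 1 := fun y h1 h2 => abs_le.2 ⟨h1, h2⟩
  have ins : ∀ x y : ℤ, -m ≤ y → y ≤ m → |x + y - x| ≤ m := fun x y h1 h2 => by
    rw [add_sub_cancel_left]; exact abs_le.2 ⟨h1, h2⟩
  rcases hcase with rfl | rfl
  -- The offsets from the centres form a zero-sum square in which only the sought one, `m + 1`,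
  -- exceeds `m` in absolute value. The bound `3 ≤ m` is needed for the offsets `±3` and to keep the
  -- `B` offsets distinct.
  · apply h.zero_step hf (s + (m + 1)) (t + -2) (w + (1 - m)) (t + -3) (w + 0) (s + 3) (w + (2 - m))
      (s + 2) (t + (m - 4))
    all_goals first
      | (apply bd _ _ ‹_›; apply ab <;> omega)
      | omega
      | (apply hA; apply ins <;> omega)
      | (apply hB; apply ins <;> omega)
      | (apply hC; apply ins <;> omega)
  · rw [sub_eq_add_neg]
    apply h.zero_step hf (s + -(m + 1)) (t + 2) (w + (m - 1)) (t + 3) (w + 0) (s + -3) (w + (m - 2))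
      (s + -2) (t + (4 - m))
    all_goals first
      | (apply bd _ _ ‹_›; apply ab <;> omega)
      | omega
      | (apply hA; apply ins <;> omega)
      | (apply hB; apply ins <;> omega)
      | (apply hC; apply ins <;> omega)

/-- The three windows grow by one index at each end simultaneously; the cyclic symmetry `rotate`
reduces all three extensions to the one for `A`. -/
theorem zeroOn_of_window (h : CollinearGrid N A B C) (hf : IsPolyLE 3 f) {s t w : ℤ}
    (hs : s + t + w = 0) (hA : ZeroOn f A s 3) (hB : ZeroOn f B t 3) (hC : ZeroOn f C w 3)
    (n : ℕ) (hsN : |s| + n + 3 ≤ N) (htN : |t| + n + 3 ≤ N) (hwN : |w| + n + 3 ≤ N) :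
    ZeroOn f A s (n + 3) ∧ ZeroOn f B t (n + 3) ∧ ZeroOn f C w (n + 3) := by
  induction n with
  | zero => simpa using ⟨hA, hB, hC⟩
  | succ n ih =>
    push_cast at hsN htN hwN
    obtain ⟨iA, iB, iC⟩ := ih (by omega) (by omega) (by omega)
    have e : ((n + 1 : ℕ) : ℤ) + 3 = (n + 3) + 1 := by push_cast; ring
    rw [e]
    exact ⟨h.zeroOn_succ hf hs (by omega) (by omega) (by omega) (by omega) iA iB iC,
      h.rotate.zeroOn_succ hf (by omega) (by omega) (by omega) (by omega) (by omega) iB iC iA,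
      h.rotate.rotate.zeroOn_succ hf (by omega) (by omega) (by omega) (by omega) (by omega) iC iA iB⟩

/-- A cubic through nine suitable points of a grid passes through the centre of the grid. -/
theorem zeroOn_three (h : CollinearGrid N A B C) (hf : IsPolyLE 3 f) (hN : 3 ≤ N)
    (hA : ∀ i ∈ Icc (-2 : ℤ) 0, f (A i) = 0) (hB : ∀ i ∈ Icc (-1 : ℤ) 0, f (B i) = 0)
    (hC : ∀ i ∈ Icc (-1 : ℤ) 2, f (C i) = 0) :
    ZeroOn f A 0 3 ∧ ZeroOn f B 0 3 ∧ ZeroOn f C 0 3 := by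
  have hb := h.rotate
  have hc := h.rotate.rotate
  have bd : ∀ i : ℤ, |i| ≤ 3 → |i| ≤ N := fun i hi => hi.trans hN
  have A_2 := hA (-2) (by simp)
  have A_1 := hA (-1) (by simp)
  have A0 := hA 0 (by simp)
  have B_1 := hB (-1) (by simp)
  have B0 := hB 0 (by simp)
  have C_1 := hC (-1) (by simp)
  have C0 := hC 0 (by simp)
  have C1 := hC 1 (by simp)
  have C2 := hC 2 (by simp)
  -- Twelve deductions, in an order where each uses eight known zeros, complete the 21 points. The
  -- nine integers list the rows of the square; with `hb` and `hc` the letters are shifted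
  -- cyclically.
  have B1 : f (B 1) = 0 := by
    refine hb.zero_step hf 1 0 (-1) 1 0 (-1) (-2) 0 2 ?_ ?_ ?_ ?_ ?_ ?_ ?_ ?_ ?_
      ?_ ?_ ?_ ?_ ?_ ?_ ?_ ?_ ?_ ?_ ?_ ?_ ?_
      B_1 B0 C0 C1 C2 A_1 A0 A_2 <;>
    first | exact bd _ (by decide) | decide
  have B2 : f (B 2) = 0 := by
    refine hb.zero_step hf 2 0 (-2) (-1) 0 1 (-1) 0 1 ?_ ?_ ?_ ?_ ?_ ?_ ?_ ?_ ?_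
      ?_ ?_ ?_ ?_ ?_ ?_ ?_ ?_ ?_ ?_ ?_ ?_ ?_
      B1 B0 C0 C_1 C1 A_2 A0 A_1 <;>
    first | exact bd _ (by decide) | decide
  have A1 : f (A 1) = 0 := by
    refine h.zero_step hf 1 (-1) 0 0 2 (-2) (-1) (-1) 2 ?_ ?_ ?_ ?_ ?_ ?_ ?_ ?_ ?_
      ?_ ?_ ?_ ?_ ?_ ?_ ?_ ?_ ?_ ?_ ?_ ?_ ?_
      A_2 A_1 B_1 B0 B2 C0 C2 C_1 <;>
    first | exact bd _ (by decide) | decide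
  have C_2 : f (C (-2)) = 0 := by
    refine hc.zero_step hf (-2) 0 2 1 0 (-1) 1 0 (-1) ?_ ?_ ?_ ?_ ?_ ?_ ?_ ?_ ?_
      ?_ ?_ ?_ ?_ ?_ ?_ ?_ ?_ ?_ ?_ ?_ ?_ ?_
      C_1 C0 A0 A1 A_1 B2 B0 B1 <;>
    first | exact bd _ (by decide) | decide
  have A2 : f (A 2) = 0 := by
    refine h.zero_step hf 2 (-1) (-1) 0 0 0 (-2) 1 1 ?_ ?_ ?_ ?_ ?_ ?_ ?_ ?_ ?_
      ?_ ?_ ?_ ?_ ?_ ?_ ?_ ?_ ?_ ?_ ?_ ?_ ?_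
      A0 A1 B_1 B0 B1 C_1 C0 C_2 <;>
    first | exact bd _ (by decide) | decide
  have B3 : f (B 3) = 0 := by
    refine hb.zero_step hf 3 (-2) (-1) (-1) 0 1 (-2) 2 0 ?_ ?_ ?_ ?_ ?_ ?_ ?_ ?_ ?_
      ?_ ?_ ?_ ?_ ?_ ?_ ?_ ?_ ?_ ?_ ?_ ?_ ?_
      B1 B2 C_2 C_1 C0 A_1 A0 A_2 <;>
    first | exact bd _ (by decide) | decide
  have B_3 : f (B (-3)) = 0 := by
    refine hb.zero_step hf (-3) 2 1 1 (-2) 1 2 0 (-2) ?_ ?_ ?_ ?_ ?_ ?_ ?_ ?_ ?_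
      ?_ ?_ ?_ ?_ ?_ ?_ ?_ ?_ ?_ ?_ ?_ ?_ ?_
      B1 B0 C2 C1 C_2 A1 A_2 A2 <;>
    first | exact bd _ (by decide) | decide
  have B_2 : f (B (-2)) = 0 := by
    refine hb.zero_step hf (-2) 2 0 0 1 (-1) 2 (-3) 1 ?_ ?_ ?_ ?_ ?_ ?_ ?_ ?_ ?_
      ?_ ?_ ?_ ?_ ?_ ?_ ?_ ?_ ?_ ?_ ?_ ?_ ?_
      B_1 B_3 C2 C0 C1 A0 A1 A2 <;>
    first | exact bd _ (by decide) | decide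
  have A_3 : f (A (-3)) = 0 := by
    refine h.zero_step hf (-3) 1 2 2 0 (-2) 1 (-1) 0 ?_ ?_ ?_ ?_ ?_ ?_ ?_ ?_ ?_
      ?_ ?_ ?_ ?_ ?_ ?_ ?_ ?_ ?_ ?_ ?_ ?_ ?_
      A_2 A_1 B1 B2 B0 C2 C0 C1 <;>
    first | exact bd _ (by decide) | decide
  have C_3 : f (C (-3)) = 0 := by
    refine hc.zero_step hf (-3) 2 1 1 (-3) 2 2 1 (-3) ?_ ?_ ?_ ?_ ?_ ?_ ?_ ?_ ?_
      ?_ ?_ ?_ ?_ ?_ ?_ ?_ ?_ ?_ ?_ ?_ ?_ ?_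
      C2 C1 A2 A1 A_3 B1 B_3 B2 <;>
    first | exact bd _ (by decide) | decide
  have A3 : f (A 3) = 0 := by
    refine h.zero_step hf 3 0 (-3) (-1) 1 0 (-2) (-1) 3 ?_ ?_ ?_ ?_ ?_ ?_ ?_ ?_ ?_
      ?_ ?_ ?_ ?_ ?_ ?_ ?_ ?_ ?_ ?_ ?_ ?_ ?_
      A0 A_1 B0 B_1 B3 C_3 C1 C_2 <;>
    first | exact bd _ (by decide) | decide
  have C3 : f (C 3) = 0 := by
    refine hc.zero_step hf 3 (-2) (-1) (-1) 2 (-1) (-2) 0 2 ?_ ?_ ?_ ?_ ?_ ?_ ?_ ?_ ?_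
      ?_ ?_ ?_ ?_ ?_ ?_ ?_ ?_ ?_ ?_ ?_ ?_ ?_
      C_1 C0 A_2 A_1 A2 B_1 B2 B_2 <;>
    first | exact bd _ (by decide) | decide
  refine ⟨fun i hi => ?_, fun i hi => ?_, fun i hi => ?_⟩ <;>
  · rw [sub_zero, abs_le] at hi
    obtain ⟨h1, h2⟩ := hi
    interval_cases i <;> assumption

end CollinearGrid

/-! ### Local addition on an arc and its dyadic one-parameter subgroup. -/

/-- `m` is the local addition that a parametrized arc `B` through `0` inherits from a group. -/
structure IsLocalAdd {G : Type*} [AddCommGroup G] (B : ℝ → G) (r ρ : ℝ) (m : ℝ → ℝ → ℝ) :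
    Prop where
  pos : 0 < ρ
  le : ρ ≤ r
  inj : InjOn B (Icc (-r) r)
  zero : B 0 = 0
  mem : ∀ s ∈ Icc (-ρ) ρ, ∀ t ∈ Icc (-ρ) ρ, m s t ∈ Icc (-r) r
  map : ∀ s ∈ Icc (-ρ) ρ, ∀ t ∈ Icc (-ρ) ρ, B (m s t) = B s + B t
  cont : ContinuousOn (fun p : ℝ × ℝ => m p.1 p.2) (Icc (-ρ) ρ ×ˢ Icc (-ρ) ρ)

/-- Continuity of `m` is inherited from the group addition: the arc is embedded, so a map into it is
continuous once its composite with `B` is. -/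
theorem exists_isLocalAdd {G : Type*} [AddCommGroup G] [TopologicalSpace G] [ContinuousAdd G]
    {B : ℝ → G} {r ρ : ℝ} (hρ : 0 < ρ) (hle : ρ ≤ r)
    (hB : IsEmbedding ((Icc (-r) r).domRestrict B)) (h0 : B 0 = 0)
    (hadd : ∀ s ∈ Icc (-ρ) ρ, ∀ t ∈ Icc (-ρ) ρ, ∃ u ∈ Icc (-r) r, B u = B s + B t) :
    ∃ m, IsLocalAdd B r ρ m := by
  have hsub : Icc (-ρ) ρ ⊆ Icc (-r) r := Icc_subset_Icc (by linarith) hle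
  have hBc : ContinuousOn B (Icc (-ρ) ρ) :=
    (continuousOn_iff_continuous_domRestrict.2 hB.continuous).mono hsub
  have hadd' : ∀ s t, ∃ u, s ∈ Icc (-ρ) ρ → t ∈ Icc (-ρ) ρ → u ∈ Icc (-r) r ∧ B u = B s + B t := by
    intro s t
    by_cases h : s ∈ Icc (-ρ) ρ ∧ t ∈ Icc (-ρ) ρ
    · obtain ⟨u, hu⟩ := hadd s h.1 t h.2
      exact ⟨u, fun _ _ => hu⟩
    · exact ⟨0, fun h1 h2 => absurd ⟨h1, h2⟩ h⟩
  choose m hm using hadd'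
  refine ⟨m, hρ, hle, injOn_iff_injective.2 hB.injective, h0, fun s hs t ht => (hm s t hs ht).1,
    fun s hs t ht => (hm s t hs ht).2, ?_⟩
  rw [continuousOn_iff_continuous_domRestrict]
  let F : (Icc (-ρ) ρ ×ˢ Icc (-ρ) ρ : Set (ℝ × ℝ)) → Icc (-r) r := fun p =>
    ⟨m p.1.1 p.1.2, (hm _ _ p.2.1 p.2.2).1⟩
  have hF : Continuous F := by
    rw [hB.continuous_iff]
    have : (Icc (-r) r).domRestrict B ∘ F = fun p => B p.1.1 + B p.1.2 :=
      funext fun p => (hm _ _ p.2.1 p.2.2).2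
    rw [this]
    refine Continuous.add ?_ ?_
    · exact hBc.comp_continuous (by fun_prop) fun p => p.2.1
    · exact hBc.comp_continuous (by fun_prop) fun p => p.2.2
  exact continuous_subtype_val.comp hF

namespace IsLocalAdd

variable {G : Type*} [AddCommGroup G] {B : ℝ → G} {r ρ : ℝ} {m : ℝ → ℝ → ℝ}

theorem subset (h : IsLocalAdd B r ρ m) : Icc (-ρ) ρ ⊆ Icc (-r) r :=
  Icc_subset_Icc (by linarith [h.le]) h.le

theorem zero_mem (h : IsLocalAdd B r ρ m) : (0 : ℝ) ∈ Icc (-ρ) ρ :=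
  ⟨by linarith [h.pos], h.pos.le⟩

theorem eq_of_map (h : IsLocalAdd B r ρ m) {s t u : ℝ} (hs : s ∈ Icc (-ρ) ρ)
    (ht : t ∈ Icc (-ρ) ρ) (hu : u ∈ Icc (-ρ) ρ) (hB : B s + B t = B u) : m s t = u :=
  h.inj (h.mem s hs t ht) (h.subset hu) (by rw [h.map s hs t ht, hB])

theorem add_zero (h : IsLocalAdd B r ρ m) {s : ℝ} (hs : s ∈ Icc (-ρ) ρ) : m s 0 = s :=
  h.eq_of_map hs h.zero_mem hs (by rw [h.zero, _root_.add_zero])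

theorem zero_add (h : IsLocalAdd B r ρ m) {s : ℝ} (hs : s ∈ Icc (-ρ) ρ) : m 0 s = s :=
  h.eq_of_map h.zero_mem hs hs (by rw [h.zero, _root_.zero_add])

theorem comm (h : IsLocalAdd B r ρ m) {s t : ℝ} (hs : s ∈ Icc (-ρ) ρ) (ht : t ∈ Icc (-ρ) ρ) :
    m s t = m t s :=
  h.inj (h.mem s hs t ht) (h.mem t ht s hs) (by rw [h.map s hs t ht, h.map t ht s hs, add_comm])

theorem cont_right (h : IsLocalAdd B r ρ m) {s : ℝ} (hs : s ∈ Icc (-ρ) ρ) :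
    ContinuousOn (fun t => m s t) (Icc (-ρ) ρ) :=
  h.cont.comp (f := fun t => (s, t)) (by fun_prop) fun t ht => ⟨hs, ht⟩

theorem cont_left (h : IsLocalAdd B r ρ m) {t : ℝ} (ht : t ∈ Icc (-ρ) ρ) :
    ContinuousOn (fun s => m s t) (Icc (-ρ) ρ) :=
  h.cont.comp (f := fun s => (s, t)) (by fun_prop) fun s hs => ⟨hs, ht⟩

/-- The difference `m s' t - m s t` is positive at `t = 0`. Were it not positive elsewhere, it would
vanish somewhere, and cancellation in the group would give `s = s'`. -/
theorem lt_left (h : IsLocalAdd B r ρ m) {s s' t : ℝ} (hs : s ∈ Icc (-ρ) ρ)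
    (hs' : s' ∈ Icc (-ρ) ρ) (ht : t ∈ Icc (-ρ) ρ) (hlt : s < s') : m s t < m s' t := by
  by_contra! hle
  have hc : ContinuousOn (fun t => m s' t - m s t) (Icc (-ρ) ρ) :=
    (h.cont_right hs').sub (h.cont_right hs)
  obtain ⟨u, hu, hu0⟩ := isPreconnected_Icc.intermediate_value ht h.zero_mem hc
    (show (0 : ℝ) ∈ Icc _ _ by
      simp only [h.add_zero hs, h.add_zero hs']
      constructor <;> linarith)
  simp only [sub_eq_zero] at hu0
  have := congrArg B hu0
  rw [h.map _ hs' _ hu, h.map _ hs _ hu, add_left_inj] at this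
  exact hlt.ne' (h.inj (h.subset hs') (h.subset hs) this)

theorem lt_right (h : IsLocalAdd B r ρ m) {s t t' : ℝ} (hs : s ∈ Icc (-ρ) ρ)
    (ht : t ∈ Icc (-ρ) ρ) (ht' : t' ∈ Icc (-ρ) ρ) (hlt : t < t') : m s t < m s t' := by
  rw [h.comm hs ht, h.comm hs ht']
  exact h.lt_left ht ht' hs hlt

theorem exists_half (h : IsLocalAdd B r ρ m) {t : ℝ} (ht0 : 0 < t) (ht : t ≤ ρ) :
    ∃ t', 0 < t' ∧ t' < t ∧ m t' t' = t := by
  have hm : ∀ {s}, s ∈ Icc 0 t → s ∈ Icc (-ρ) ρ := fun hs =>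
    ⟨by linarith [hs.1, h.pos], hs.2.trans ht⟩
  have htI : t ∈ Icc (-ρ) ρ := hm ⟨ht0.le, le_rfl⟩
  have hc : ContinuousOn (fun s => m s s) (Icc 0 t) :=
    h.cont.comp (f := fun s => (s, s)) (by fun_prop) fun s hs => ⟨hm hs, hm hs⟩
  have hgt : t < m t t := by
    simpa only [h.add_zero htI] using h.lt_right htI h.zero_mem htI ht0
  obtain ⟨s, hs, hst⟩ := intermediate_value_Icc ht0.le hc
    (show t ∈ Icc _ _ from ⟨by rw [h.add_zero h.zero_mem]; exact ht0.le, hgt.le⟩)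
  refine ⟨s, hs.1.lt_of_ne ?_, hs.2.lt_of_ne ?_, hst⟩
  · rintro rfl
    simp only [h.add_zero h.zero_mem] at hst
    exact ht0.ne hst
  · rintro rfl
    simp only at hst
    exact hgt.ne' hst

/-- For small `s ≥ 0`, `m s (-ρ)` is still negative while `m s 0 = s ≥ 0`; a zero in between is the
inverse of `s`. -/
theorem exists_neg (h : IsLocalAdd B r ρ m) :
    ∃ T, 0 < T ∧ T ≤ ρ ∧ ∀ s ∈ Icc 0 T, ∃ t ∈ Icc (-ρ) 0, B t = -B s := by
  have hρ : -ρ ∈ Icc (-ρ) ρ := ⟨le_rfl, by linarith [h.pos]⟩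
  have hev : ∀ᶠ s in 𝓝[Icc (-ρ) ρ] 0, m s (-ρ) < 0 := by
    refine (h.cont_left hρ 0 h.zero_mem).eventually_lt_const ?_
    simp only [h.zero_add hρ]
    linarith [h.pos]
  rw [eventually_nhdsWithin_iff, Metric.eventually_nhds_iff] at hev
  obtain ⟨ε, hε, hev⟩ := hev
  refine ⟨min ρ (ε / 2), lt_min h.pos (by positivity), min_le_left _ _, fun s hs => ?_⟩
  have hsI : s ∈ Icc (-ρ) ρ := ⟨by linarith [hs.1, h.pos], hs.2.trans (min_le_left _ _)⟩
  have hlt : m s (-ρ) < 0 := hev (by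
    rw [Real.dist_eq, sub_zero, abs_of_nonneg hs.1]
    linarith [hs.2.trans (min_le_right _ _)]) hsI
  obtain ⟨t, ht, hst⟩ := intermediate_value_Icc (by linarith [h.pos] : -ρ ≤ 0)
    ((h.cont_right hsI).mono (Icc_subset_Icc le_rfl h.pos.le))
    (show (0 : ℝ) ∈ Icc _ _ from ⟨hlt.le, by rw [h.add_zero hsI]; exact hs.1⟩)
  refine ⟨t, ht, ?_⟩
  have := h.map s hsI t ⟨ht.1, by linarith [ht.2, h.pos]⟩
  simp only at hst
  rw [hst, h.zero] at this
  rw [eq_neg_iff_add_eq_zero, add_comm, ← this]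

/-- Successive halvings of a small parameter. -/
theorem exists_halvings (h : IsLocalAdd B r ρ m) {T₀ : ℝ} (hT₀ : 0 < T₀) (hT₀' : T₀ ≤ ρ) :
    ∃ T : ℕ → ℝ, T 0 = T₀ ∧ (∀ n, 0 < T n ∧ T n ≤ T₀) ∧ (∀ n, T (n + 1) < T n) ∧
      (∀ n, B (T n) = B (T (n + 1)) + B (T (n + 1))) ∧ Filter.Tendsto T Filter.atTop (𝓝 0) := by
  have hex : ∀ t, ∃ t', 0 < t → t ≤ ρ → 0 < t' ∧ t' < t ∧ m t' t' = t := by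
    intro t
    by_cases ht : 0 < t ∧ t ≤ ρ
    · obtain ⟨t', ht'⟩ := h.exists_half ht.1 ht.2
      exact ⟨t', fun _ _ => ht'⟩
    · exact ⟨0, fun h1 h2 => absurd ⟨h1, h2⟩ ht⟩
  choose half hhalf using hex
  set T : ℕ → ℝ := fun n => half^[n] T₀ with hT
  have hsucc : ∀ n, T (n + 1) = half (T n) := fun n => Function.iterate_succ_apply' _ _ _
  have hpos : ∀ n, 0 < T n ∧ T n ≤ T₀ := by
    intro n
    induction n with
    | zero => exact ⟨hT₀, le_rfl⟩
    | succ n ih =>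
      rw [hsucc]
      obtain ⟨h1, h2, -⟩ := hhalf (T n) ih.1 (ih.2.trans hT₀')
      exact ⟨h1, h2.le.trans ih.2⟩
  have hI : ∀ n, T n ∈ Icc (-ρ) ρ := fun n =>
    ⟨by linarith [(hpos n).1, h.pos], (hpos n).2.trans hT₀'⟩
  have hlt : ∀ n, T (n + 1) < T n := fun n => by
    rw [hsucc]; exact (hhalf (T n) (hpos n).1 (hI n).2).2.1
  have hm : ∀ n, m (T (n + 1)) (T (n + 1)) = T n := fun n => by
    rw [hsucc]; exact (hhalf (T n) (hpos n).1 (hI n).2).2.2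
  refine ⟨T, rfl, hpos, hlt, fun n => ?_, ?_⟩
  · rw [← h.map _ (hI _) _ (hI _), hm]
  -- The decreasing halvings have a limit `L`, and by continuity `m L L = L`. Hence `B L = 0` and `L
  -- = 0`.
  · have hbdd : BddBelow (range T) := ⟨0, by rintro _ ⟨n, rfl⟩; exact (hpos n).1.le⟩
    have hlim := tendsto_atTop_ciInf (antitone_nat_of_succ_le fun n => (hlt n).le) hbdd
    set L := ⨅ n, T n
    have hL : L ∈ Icc (-ρ) ρ := isClosed_Icc.mem_of_tendsto hlim (Filter.Eventually.of_forall hI)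
    have h1 : Filter.Tendsto (fun n => m (T (n + 1)) (T (n + 1))) Filter.atTop (𝓝 (m L L)) := by
      have hc := h.cont (L, L) ⟨hL, hL⟩
      have hlim' := hlim.comp (Filter.tendsto_add_atTop_nat 1)
      exact hc.tendsto.comp (tendsto_nhdsWithin_iff.2
        ⟨hlim'.prodMk_nhds hlim', Filter.Eventually.of_forall fun n => ⟨hI _, hI _⟩⟩)
    simp only [hm] at h1
    have h2 := tendsto_nhds_unique h1 hlim
    have h3 := h.map L hL L hL
    rw [h2, left_eq_add, ← h.zero] at h3
    rwa [h.inj (h.subset hL) (h.subset h.zero_mem) h3] at hlim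

end IsLocalAdd

/-- A family of finer and finer integer scales `X n : ℤ → ℝ` around `x₀`. -/
structure IsDyadicScale (x₀ : ℝ) (X : ℕ → ℤ → ℝ) : Prop where
  mono : ∀ n, StrictMonoOn (X n) (Icc (-2 ^ n) (2 ^ n))
  zero : ∀ n, X n 0 = x₀
  nested : ∀ n k, |k| ≤ 2 ^ n → X (n + 1) (2 * k) = X n k
  small : ∀ (K : ℕ) (ε : ℝ), 0 < ε → ∃ N, ∀ n ≥ N, (K : ℤ) ≤ 2 ^ n ∧ X n K < x₀ + ε ∧
    x₀ - ε < X n (-K)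
  dense : ∃ η > 0, ∀ u v, x₀ - η < u → u < v → v < x₀ + η →
    ∃ N, ∀ n ≥ N, ∃ k, 2 * |k| ≤ 2 ^ n ∧ X n k ∈ Ioo u v

namespace IsLocalAdd

variable {G : Type*} [AddCommGroup G] {B : ℝ → G} {r ρ : ℝ} {m : ℝ → ℝ → ℝ}

/-- Even multiples of the halved step are multiples of the old one. An odd multiple lies between two
neighbouring old multiples by monotonicity, so it never leaves `[0, T 0]`. -/
theorem exists_nsmul (h : IsLocalAdd B r ρ m) {T : ℕ → ℝ} (hT : ∀ n, 0 < T n ∧ T n ≤ T 0)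
    (hρ : T 0 ≤ ρ) (hlt : ∀ n, T (n + 1) < T n)
    (hB : ∀ n, B (T n) = B (T (n + 1)) + B (T (n + 1))) (n k : ℕ) (hk : k ≤ 2 ^ n) :
    ∃ s ∈ Icc 0 (T 0), B s = k • B (T n) := by
  have hI : ∀ {s}, s ∈ Icc 0 (T 0) → s ∈ Icc (-ρ) ρ := fun hs =>
    ⟨by linarith [hs.1, h.pos], hs.2.trans hρ⟩
  have hTI : ∀ n, T n ∈ Icc (-ρ) ρ := fun n => hI ⟨(hT n).1.le, (hT n).2⟩
  induction n generalizing k with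
  | zero =>
    rw [pow_zero] at hk
    interval_cases k
    · exact ⟨0, ⟨le_rfl, (hT 0).1.le⟩, by rw [h.zero, zero_nsmul]⟩
    · exact ⟨T 0, ⟨(hT 0).1.le, le_rfl⟩, by rw [one_nsmul]⟩
  | succ n ih =>
    rw [pow_succ] at hk
    obtain ⟨j, rfl | rfl⟩ := k.even_or_odd'
    · obtain ⟨s, hs, hsB⟩ := ih j (by omega)
      refine ⟨s, hs, ?_⟩
      rw [hsB, hB n, mul_comm, mul_nsmul', two_nsmul]
    · obtain ⟨s, hs, hsB⟩ := ih j (by omega)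
      obtain ⟨s', hs', hsB'⟩ := ih (j + 1) (by omega)
      have e : m s (T n) = s' := h.eq_of_map (hI hs) (hTI n) (hI hs') (by
        rw [hsB, hsB', succ_nsmul])
      have h1 := h.lt_right (hI hs) (hTI (n + 1)) (hTI n) (hlt n)
      have h2 := h.lt_right (hI hs) h.zero_mem (hTI (n + 1)) (hT (n + 1)).1
      rw [h.add_zero (hI hs)] at h2
      refine ⟨m s (T (n + 1)), ⟨hs.1.trans h2.le, (h1.trans_eq e).le.trans hs'.2⟩, ?_⟩
      rw [h.map _ (hI hs) _ (hTI _), hsB, succ_nsmul, hB n, mul_comm, mul_nsmul', two_nsmul]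

/-- A local one-parameter subgroup, on the dyadic rationals. -/
theorem exists_dyadicScale (h : IsLocalAdd B r ρ m) :
    ∃ (g : ℕ → G) (H : ℕ → ℤ → ℝ), IsDyadicScale 0 H ∧
      ∀ n k, |k| ≤ 2 ^ n → H n k ∈ Icc (-ρ) ρ ∧ B (H n k) = k • g n := by
  obtain ⟨T₀, hT₀, hT₀ρ, hneg⟩ := h.exists_neg
  obtain ⟨T, rfl, hT, hlt, hB, hlim⟩ := h.exists_halvings hT₀ hT₀ρ
  have hTI : ∀ n, T n ∈ Icc (-ρ) ρ := fun n =>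
    ⟨by linarith [(hT n).1, h.pos], (hT n).2.trans hT₀ρ⟩
  have hex : ∀ (n : ℕ) (k : ℤ), ∃ s, |k| ≤ 2 ^ n → s ∈ Icc (-ρ) ρ ∧ B s = k • B (T n) := by
    intro n k
    by_cases hk : |k| ≤ 2 ^ n
    swap
    · exact ⟨0, fun h => absurd h hk⟩
    obtain ⟨s, hs, hsB⟩ := h.exists_nsmul hT hT₀ρ hlt hB n k.natAbs (by zify; exact hk)
    rcases le_total 0 k with h0 | h0
    · refine ⟨s, fun _ => ⟨⟨by linarith [hs.1, h.pos], hs.2.trans hT₀ρ⟩, ?_⟩⟩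
      rw [hsB, ← natCast_zsmul, Int.natAbs_of_nonneg h0]
    · obtain ⟨t, ht, htB⟩ := hneg s hs
      refine ⟨t, fun _ => ⟨⟨ht.1, by linarith [ht.2, h.pos]⟩, ?_⟩⟩
      rw [htB, hsB, ← natCast_zsmul, Int.ofNat_natAbs_of_nonpos h0, neg_zsmul, neg_neg]
  choose H hH using hex
  have hHI : ∀ {n k}, |k| ≤ 2 ^ n → H n k ∈ Icc (-ρ) ρ := fun hk => (hH _ _ hk).1
  have hHB : ∀ {n k}, |k| ≤ 2 ^ n → B (H n k) = k • B (T n) := fun hk => (hH _ _ hk).2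
  have hsucc : ∀ n (k : ℤ), -2 ^ n ≤ k → k + 1 ≤ 2 ^ n → H n (k + 1) = m (H n k) (T n) := by
    intro n k h1 h2
    have hk : |k| ≤ 2 ^ n := abs_le.2 ⟨h1, by omega⟩
    have hk' : |k + 1| ≤ 2 ^ n := abs_le.2 ⟨by omega, h2⟩
    exact (h.eq_of_map (hHI hk) (hTI n) (hHI hk') (by
      rw [hHB hk, hHB hk', add_zsmul, one_zsmul])).symm
  have hzero : ∀ n, H n 0 = 0 := fun n => by
    have h0 : |(0 : ℤ)| ≤ 2 ^ n := by simp
    exact h.inj (h.subset (hHI h0)) (h.subset h.zero_mem) (by rw [hHB h0, h.zero, zero_zsmul])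
  have hmono : ∀ n, StrictMonoOn (H n) (Icc (-2 ^ n) (2 ^ n)) := by
    intro n
    refine strictMonoOn_of_lt_add_one ordConnected_Icc fun k _ hk hk' => ?_
    rw [hsucc n k hk.1 hk'.2]
    have hkI := hHI (abs_le.2 hk)
    simpa only [h.add_zero hkI] using h.lt_right hkI h.zero_mem (hTI n) (hT n).1
  have hnested : ∀ n k, |k| ≤ 2 ^ n → H (n + 1) (2 * k) = H n k := by
    intro n k hk
    have hk' : |2 * k| ≤ 2 ^ (n + 1) := by
      rw [abs_mul, pow_succ]; simp only [Nat.abs_ofNat]; omega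
    refine h.inj (h.subset (hHI hk')) (h.subset (hHI hk)) ?_
    rw [hHB hk, hHB hk', hB n, mul_comm, mul_zsmul, two_zsmul]
  -- A gap of the grid is `m (H n k) (T n) - m (H n k) 0`, which tends to `0` uniformly in `k`
  -- because `m` is uniformly continuous on the compact square.
  have hmesh : ∀ ε > 0, ∃ N, ∀ n ≥ N, ∀ k : ℤ, -2 ^ n ≤ k → k + 1 ≤ 2 ^ n →
      H n (k + 1) < H n k + ε := by
    intro ε hε
    obtain ⟨δ, hδ, hunif⟩ := Metric.uniformContinuousOn_iff.1
      ((isCompact_Icc.prod isCompact_Icc).uniformContinuousOn_of_continuous h.cont) ε hε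
    obtain ⟨N, hN⟩ := Metric.tendsto_atTop.1 hlim δ hδ
    refine ⟨N, fun n hn k h1 h2 => ?_⟩
    have hkI := hHI (abs_le.2 ⟨h1, by omega⟩)
    have := hunif (H n k, T n) ⟨hkI, hTI n⟩ (H n k, 0) ⟨hkI, h.zero_mem⟩ (by
      rw [Prod.dist_eq, dist_self, max_eq_right dist_nonneg]; exact hN n hn)
    simp only [h.add_zero hkI, ← hsucc n k h1 h2, Real.dist_eq] at this
    linarith [(abs_lt.1 this).2]
  have hpow : ∀ K : ℕ, ∀ n ≥ K, (K : ℤ) ≤ 2 ^ n := fun K n hn => by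
    have h1 : K < 2 ^ K := Nat.lt_two_pow_self
    have h2 : 2 ^ K ≤ 2 ^ n := Nat.pow_le_pow_right (by norm_num) hn
    exact_mod_cast h1.le.trans h2
  refine ⟨fun n => B (T n), H, ⟨hmono, hzero, hnested, fun K ε hε => ?_, ?_⟩, hH⟩
  · obtain ⟨N, hN⟩ := hmesh (ε / (K + 1)) (by positivity)
    refine ⟨max N K, fun n hn => ?_⟩
    have hKn := hpow K n (le_of_max_le_right hn)
    have hN := hN n (le_of_max_le_left hn)
    have up : ∀ j : ℕ, j ≤ K → H n j ≤ j * (ε / (K + 1)) ∧ -(j * (ε / (K + 1))) ≤ H n (-j) := by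
      intro j
      induction j with
      | zero => intro; simp [hzero]
      | succ j ih =>
        intro hj
        obtain ⟨i1, i2⟩ := ih (by omega)
        have h1 := hN j (by omega) (by omega)
        have h2 := hN (-(j + 1)) (by omega) (by omega)
        rw [show -((j : ℤ) + 1) + 1 = -j by ring] at h2
        push_cast
        constructor <;> linarith
    obtain ⟨h1, h2⟩ := up K le_rfl
    have h3 : K * (ε / (K + 1)) < ε := by
      rw [mul_div_assoc', div_lt_iff₀ (by positivity)]
      nlinarith
    exact ⟨hKn, by linarith, by linarith⟩
  -- The points at half the maximal index do not depend on the level, so they bound a fixed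
  -- neighbourhood that the indices with `2 * |k| ≤ 2 ^ n` fill densely.
  · have hhalf : ∀ n, H (n + 1) (2 ^ n) = H 1 1 ∧ H (n + 1) (-2 ^ n) = H 1 (-1) := by
      intro n
      induction n with
      | zero => simp
      | succ n ih =>
        have hn : |(2 : ℤ) ^ n| ≤ 2 ^ (n + 1) := by
          rw [abs_of_pos (by positivity), pow_succ]; linarith [pow_pos (two_pos (α := ℤ)) n]
        rw [← ih.1, ← ih.2, ← hnested (n + 1) _ hn, ← hnested (n + 1) (-2 ^ n) (by rwa [abs_neg])]
        constructor <;> congr 1 <;> ring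
    have hp1 : 0 < H 1 1 := by
      rw [← hzero 1]; exact hmono 1 (by simp) (by simp) (by norm_num)
    have hn1 : H 1 (-1) < 0 := by
      rw [← hzero 1]; exact hmono 1 (by simp) (by simp) (by norm_num)
    refine ⟨min (H 1 1) (-H 1 (-1)), lt_min hp1 (by linarith), fun u v hu huv hv => ?_⟩
    have hu' : H 1 (-1) < u := by linarith [min_le_right (H 1 1) (-H 1 (-1))]
    have hv' : v < H 1 1 := by linarith [min_le_left (H 1 1) (-H 1 (-1))]
    obtain ⟨N, hN⟩ := hmesh (v - u) (by linarith)
    refine ⟨N + 1, fun n hn => ?_⟩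
    obtain ⟨n, rfl⟩ : ∃ n', n = n' + 1 := ⟨n - 1, by omega⟩
    have hN := hN (n + 1) (by omega)
    obtain ⟨e1, e2⟩ := hhalf n
    have hP : (0 : ℤ) < 2 ^ n := by positivity
    set P : ℤ := 2 ^ n with hPdef
    have hpw : (2 : ℤ) ^ (n + 1) = 2 * P := by rw [pow_succ]; ring
    have hexj : ∃ j : ℕ, u < H (n + 1) (-P + j) := ⟨(2 * P).toNat, by
      rw [Int.toNat_of_nonneg (by omega), show -P + 2 * P = P by ring, e1]; linarith⟩
    classical
    -- The first grid point beyond `u`, scanning from the left, comes less than one mesh `v - u`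
    -- after a point that is at most `u`, so it lies before `v`.
    have hj := Nat.find_spec hexj
    have hmin := fun i => Nat.find_min hexj (m := i)
    have hle : Nat.find hexj ≤ (2 * P).toNat := Nat.find_min' hexj (by
      rw [Int.toNat_of_nonneg (by omega), show -P + 2 * P = P by ring, e1]; linarith)
    set j := Nat.find hexj
    have hj0 : j ≠ 0 := by
      intro h0
      rw [h0] at hj
      simp only [Nat.cast_zero, _root_.add_zero, e2] at hj
      linarith
    obtain ⟨i, hi⟩ := Nat.exists_eq_succ_of_ne_zero hj0
    have hlow : H (n + 1) (-P + i) ≤ u := not_lt.1 (hmin i (by omega))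
    have hstep := hN (-P + i) (by omega) (by omega)
    rw [hi] at hj
    push_cast at hj
    rw [← add_assoc] at hj
    refine ⟨-P + i + 1, ?_, hj, by linarith⟩
    rw [hpw]
    have : |-P + i + 1| ≤ P := abs_le.2 ⟨by omega, by omega⟩
    linarith

end IsLocalAdd

/-! ### Lines, determinants and parametrization of the curves by abscissas. -/

theorem exists_eq_lineMap_of_det3_eq_zero {P Q R : ℝ × ℝ} (h : P ≠ Q) (hR : det3 P Q R = 0) :
    ∃ t : ℝ, R = t • (Q - P) + P := by
  simp only [det3] at hR
  by_cases hx : Q.1 - P.1 = 0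
  · have hy : Q.2 - P.2 ≠ 0 := fun hy => h (Prod.ext (by linarith) (by linarith))
    refine ⟨(R.2 - P.2) / (Q.2 - P.2), ?_⟩
    rw [hx, zero_mul, zero_sub, neg_eq_zero] at hR
    have h1 := (mul_eq_zero.1 hR).resolve_left hy
    refine Prod.ext ?_ ?_
    · simp only [Prod.fst_add, Prod.smul_fst, Prod.fst_sub, hx, smul_eq_mul]; linarith
    · simp only [Prod.snd_add, Prod.smul_snd, Prod.snd_sub, smul_eq_mul]
      rw [div_mul_cancel₀ _ hy]; ring
  · refine ⟨(R.1 - P.1) / (Q.1 - P.1), ?_⟩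
    refine Prod.ext ?_ ?_
    · simp only [Prod.fst_add, Prod.smul_fst, Prod.fst_sub, smul_eq_mul]
      rw [div_mul_cancel₀ _ hx]; ring
    · simp only [Prod.snd_add, Prod.smul_snd, Prod.snd_sub, smul_eq_mul]
      field_simp
      linarith

theorem collinear_iff_det3 {P Q R : ℝ × ℝ} :
    Collinear ℝ {P, Q, R} ↔ det3 P Q R = 0 := by
  constructor
  · intro h
    obtain ⟨v, hv⟩ := (collinear_iff_of_mem (p₀ := P) (by simp)).1 h
    obtain ⟨s, rfl⟩ := hv Q (by simp)
    obtain ⟨t, rfl⟩ := hv R (by simp)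
    simp only [det3, vadd_eq_add, Prod.fst_add, Prod.snd_add, Prod.smul_fst, Prod.smul_snd,
      smul_eq_mul]
    ring
  · intro h
    by_cases hPQ : P = Q
    · subst hPQ
      simpa using collinear_pair ℝ P R
    obtain ⟨t, ht⟩ := exists_eq_lineMap_of_det3_eq_zero hPQ h
    refine (collinear_iff_of_mem (p₀ := P) (by simp)).2 ⟨Q - P, ?_⟩
    simp only [mem_insert_iff, mem_singleton_iff, vadd_eq_add]
    rintro S (rfl | rfl | rfl)
    · exact ⟨0, by simp⟩
    · exact ⟨1, by simp⟩
    · exact ⟨t, ht⟩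

theorem LinesThroughMeetAtMostOnce.eq_of_det3 {Γ Δ : Set (ℝ × ℝ)}
    (h : LinesThroughMeetAtMostOnce Γ Δ) {P Q R : ℝ × ℝ} (hP : P ∈ Γ) (hQ : Q ∈ Δ) (hR : R ∈ Δ)
    (h0 : det3 P Q R = 0) : Q = R := by
  by_contra hne
  refine hne (h (line[ℝ, Q, R]) ?_ ⟨P, ?_, hP⟩ ⟨left_mem_affineSpan_pair ℝ Q R, hQ⟩
    ⟨right_mem_affineSpan_pair ℝ Q R, hR⟩)
  · rw [IsStraightLine, direction_affineSpan, vectorSpan_pair_rev]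
    exact finrank_span_singleton (by simpa [sub_eq_zero] using Ne.symm hne)
  · obtain ⟨t, ht⟩ := exists_eq_lineMap_of_det3_eq_zero hne
      (by rw [← det3_rotate]; exact h0 : det3 Q R P = 0)
    rw [ht]
    exact AffineMap.lineMap_mem_affineSpan_pair t Q R

/-- Parametrized form of `CollinearityDescribedBy`. -/
structure CollinearityCoords {G : Type*} [AddCommGroup G] [TopologicalSpace G] (D : Set ℝ)
    (α β γ : ℝ → ℝ) (a b c : ℝ → G) : Prop where
  emb_a : IsEmbedding (D.domRestrict a)
  emb_b : IsEmbedding (D.domRestrict b)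
  emb_c : IsEmbedding (D.domRestrict c)
  iff : ∀ x ∈ D, ∀ y ∈ D, ∀ z ∈ D,
    det3 (x, α x) (y, β y) (z, γ z) = 0 ↔ a x + b y + c z = 0

theorem exists_embedding_of_graphOn {G : Type*} [Zero G] [TopologicalSpace G] {D : Set ℝ}
    {α : ℝ → ℝ} (hα : ContinuousOn α D) {f : D.graphOn α → G} (hf : IsEmbedding f) :
    ∃ a : ℝ → G, IsEmbedding (D.domRestrict a) ∧
      ∀ x (hx : x ∈ D), a x = f ⟨(x, α x), mem_image_of_mem _ hx⟩ := by
  classical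
  refine ⟨fun x => if hx : x ∈ D then f ⟨(x, α x), mem_image_of_mem _ hx⟩ else 0, ?_,
    fun x hx => dif_pos hx⟩
  let q : D → D.graphOn α := fun x => ⟨(x.1, α x.1), mem_image_of_mem _ x.2⟩
  have hqc : Continuous q :=
    (continuous_subtype_val.prodMk (continuousOn_iff_continuous_domRestrict.1 hα)).subtype_mk _
  have hq : IsEmbedding q := by
    refine IsEmbedding.of_comp hqc (continuous_fst.comp continuous_subtype_val) ?_
    exact IsEmbedding.subtypeVal
  convert hf.comp hq using 1
  funext x
  simp [q, domRestrict_apply]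

namespace IsStandardSystem

variable {D : Set ℝ} {α β γ : ℝ → ℝ}

theorem α_lt_γ (h : IsStandardSystem D α β γ) (x : ℝ) (hx : x ∈ D) : α x < γ x :=
  (h.α_lt_β x hx).trans (h.β_lt_γ x hx)

theorem ne_αβ (h : IsStandardSystem D α β γ) {x y : ℝ} (hx : x ∈ D) :
    ((x, α x) : ℝ × ℝ) ≠ (y, β y) := by
  intro e
  obtain ⟨rfl, e⟩ := Prod.mk.inj e
  exact (h.α_lt_β x hx).ne e

theorem ne_αγ (h : IsStandardSystem D α β γ) {x y : ℝ} (hx : x ∈ D) :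
    ((x, α x) : ℝ × ℝ) ≠ (y, γ y) := by
  intro e
  obtain ⟨rfl, e⟩ := Prod.mk.inj e
  exact (h.α_lt_γ x hx).ne e

theorem ne_βγ (h : IsStandardSystem D α β γ) {x y : ℝ} (hx : x ∈ D) :
    ((x, β x) : ℝ × ℝ) ≠ (y, γ y) := by
  intro e
  obtain ⟨rfl, e⟩ := Prod.mk.inj e
  exact (h.β_lt_γ x hx).ne e

theorem exists_coords (h : IsStandardSystem D α β γ) {G : Type*} [AddCommGroup G]
    [TopologicalSpace G]
    (hG : CollinearityDescribedBy (D.graphOn α) (D.graphOn β) (D.graphOn γ) G) :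
    ∃ a b c : ℝ → G, CollinearityCoords D α β γ a b c := by
  obtain ⟨f₁, f₂, f₃, h₁, h₂, h₃, hcol⟩ := hG
  obtain ⟨a, ha, ha'⟩ := exists_embedding_of_graphOn h.continuousOn_α h₁
  obtain ⟨b, hb, hb'⟩ := exists_embedding_of_graphOn h.continuousOn_β h₂
  obtain ⟨c, hc, hc'⟩ := exists_embedding_of_graphOn h.continuousOn_γ h₃
  refine ⟨a, b, c, ha, hb, hc, fun x hx y hy z hz => ?_⟩
  rw [ha' x hx, hb' y hy, hc' z hz, ← hcol _ _ _ (h.ne_αβ hx) (h.ne_αγ hx) (h.ne_βγ hy),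
    collinear_iff_det3]

/-- Between any two abscissas there is a point of the middle curve on the line through the
corresponding points of the outer curves. -/
theorem exists_between (h : IsStandardSystem D α β γ) {x z : ℝ} (hx : x ∈ D) (hz : z ∈ D) :
    ∃ y ∈ uIcc x z, det3 (x, α x) (y, β y) (z, γ z) = 0 := by
  have hsub : uIcc x z ⊆ D := h.ordConnected.uIcc_subset hx hz
  have hc : ContinuousOn (fun y => det3 (x, α x) (y, β y) (z, γ z)) (uIcc x z) := by
    have := h.continuousOn_β.mono hsub
    simp only [det3]
    fun_prop
  -- At `y = x` the determinant is `-(β x - α x) * (z - x)` and at `y = z` it is `(γ z - β z) * (z -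
  -- x)`; the signs are opposite.
  refine intermediate_value_uIcc hc ?_
  have h1 := h.α_lt_β x hx
  have h2 := h.β_lt_γ z hz
  simp only [det3, sub_self, zero_mul, zero_sub]
  rcases le_total x z with hxz | hxz
  · refine mem_uIcc.2 (Or.inl ⟨?_, ?_⟩) <;> nlinarith
  · refine mem_uIcc.2 (Or.inr ⟨?_, ?_⟩) <;> nlinarith

end IsStandardSystem

/-! ### Dyadic scales compatible with collinearity on the three curves. -/

/-- Transport of a dyadic scale along an increasing homeomorphism. -/
theorem IsDyadicScale.exists_transport {H : ℕ → ℤ → ℝ} (hH : IsDyadicScale 0 H) {x₀ r ρ : ℝ}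
    (hr : 0 < r) (hHρ : ∀ n k, |k| ≤ 2 ^ n → H n k ∈ Icc (-ρ) ρ) {φ : ℝ → ℝ}
    (hc : ContinuousOn φ (Icc (x₀ - r) (x₀ + r))) (hm : StrictMonoOn φ (Icc (x₀ - r) (x₀ + r)))
    (h0 : φ x₀ = x₀) (hρ : φ (x₀ - r) ≤ x₀ - ρ) (hρ' : x₀ + ρ ≤ φ (x₀ + r)) :
    ∃ X, IsDyadicScale x₀ X ∧
      ∀ n k, |k| ≤ 2 ^ n → X n k ∈ Icc (x₀ - r) (x₀ + r) ∧ φ (X n k) = x₀ + H n k := by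
  have hx₀ : x₀ ∈ Icc (x₀ - r) (x₀ + r) := ⟨by linarith, by linarith⟩
  have hex : ∀ (n : ℕ) (k : ℤ), ∃ x, |k| ≤ 2 ^ n →
      x ∈ Icc (x₀ - r) (x₀ + r) ∧ φ x = x₀ + H n k := by
    intro n k
    by_cases hk : |k| ≤ 2 ^ n
    · obtain ⟨x, hx, hxH⟩ := intermediate_value_Icc (by linarith) hc
        (show x₀ + H n k ∈ Icc _ _ from
          ⟨by linarith [(hHρ n k hk).1], by linarith [(hHρ n k hk).2]⟩)
      exact ⟨x, fun _ => ⟨hx, hxH⟩⟩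
    · exact ⟨0, fun h => absurd h hk⟩
  choose X hX using hex
  have hlt : ∀ {n k}, |k| ≤ 2 ^ n → ∀ {u}, u ∈ Icc (x₀ - r) (x₀ + r) →
      (X n k < u ↔ H n k < φ u - x₀) := fun hk u hu => by
    rw [← hm.lt_iff_lt (hX _ _ hk).1 hu, (hX _ _ hk).2]
    constructor <;> intro <;> linarith
  have hgt : ∀ {n k}, |k| ≤ 2 ^ n → ∀ {u}, u ∈ Icc (x₀ - r) (x₀ + r) →
      (u < X n k ↔ φ u - x₀ < H n k) := fun hk u hu => by
    rw [← hm.lt_iff_lt hu (hX _ _ hk).1, (hX _ _ hk).2]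
    constructor <;> intro <;> linarith
  refine ⟨X, ⟨fun n k hk l hl hkl => ?_, fun n => ?_, fun n k hk => ?_, fun K ε hε => ?_, ?_⟩, hX⟩
  · rw [hlt (abs_le.2 hk) (hX n l (abs_le.2 hl)).1, (hX n l (abs_le.2 hl)).2]
    linarith [hH.mono n hk hl hkl]
  · have h0' : |(0 : ℤ)| ≤ 2 ^ n := by simp
    exact hm.injOn (hX n 0 h0').1 hx₀ (by rw [(hX n 0 h0').2, hH.zero, h0, add_zero])
  · have hk' : |2 * k| ≤ 2 ^ (n + 1) := by
      rw [abs_mul, pow_succ]; simp only [Nat.abs_ofNat]; omega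
    exact hm.injOn (hX _ _ hk').1 (hX _ _ hk).1 (by
      rw [(hX _ _ hk').2, (hX _ _ hk).2, hH.nested n k hk])
  · set ε₁ := min ε r
    have hε₁ : 0 < ε₁ := lt_min hε hr
    have hu : x₀ + ε₁ ∈ Icc (x₀ - r) (x₀ + r) :=
      ⟨by linarith, by linarith [min_le_right ε r]⟩
    have hl : x₀ - ε₁ ∈ Icc (x₀ - r) (x₀ + r) :=
      ⟨by linarith [min_le_right ε r], by linarith⟩
    have h1 := hm hx₀ hu (by linarith)
    have h2 := hm hl hx₀ (by linarith)
    rw [h0] at h1 h2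
    obtain ⟨N, hN⟩ := hH.small K (min (φ (x₀ + ε₁) - x₀) (x₀ - φ (x₀ - ε₁)))
      (lt_min (by linarith) (by linarith))
    refine ⟨N, fun n hn => ?_⟩
    obtain ⟨k1, k2, k3⟩ := hN n hn
    have e1 : |(K : ℤ)| ≤ 2 ^ n := by rwa [Nat.abs_cast]
    have e2 : |-(K : ℤ)| ≤ 2 ^ n := by rwa [abs_neg]
    refine ⟨k1, ?_, ?_⟩
    · have := (hlt e1 hu).2 (by linarith [min_le_left (φ (x₀ + ε₁) - x₀) (x₀ - φ (x₀ - ε₁))])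
      linarith [min_le_left ε r]
    · have := (hgt e2 hl).2 (by linarith [min_le_right (φ (x₀ + ε₁) - x₀) (x₀ - φ (x₀ - ε₁))])
      linarith [min_le_left ε r]
  · obtain ⟨η₀, hη₀, hd⟩ := hH.dense
    obtain ⟨δ, hδ, hcδ⟩ := Metric.continuousOn_iff.1 hc x₀ hx₀ η₀ hη₀
    refine ⟨min r δ, lt_min hr hδ, fun u v hu huv hv => ?_⟩
    have r1 := min_le_left r δ
    have r2 := min_le_right r δ
    have huI : u ∈ Icc (x₀ - r) (x₀ + r) := ⟨by linarith, by linarith⟩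
    have hvI : v ∈ Icc (x₀ - r) (x₀ + r) := ⟨by linarith, by linarith⟩
    have du := hcδ u huI (by rw [Real.dist_eq, abs_lt]; constructor <;> linarith)
    have dv := hcδ v hvI (by rw [Real.dist_eq, abs_lt]; constructor <;> linarith)
    rw [h0, Real.dist_eq, abs_lt] at du dv
    obtain ⟨N, hN⟩ := hd (φ u - x₀) (φ v - x₀) (by linarith) (by linarith [hm huI hvI huv])
      (by linarith)
    refine ⟨N, fun n hn => ?_⟩
    obtain ⟨k, hk, hk1, hk2⟩ := hN n hn
    have hk' : |k| ≤ 2 ^ n := by linarith [abs_nonneg k]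
    exact ⟨k, hk, (hgt hk' huI).2 hk1, (hlt hk' hvI).2 hk2⟩

/-- The relation `a x + b (φ x) = e` makes `φ` continuous and injective, hence strictly monotone. It
cannot decrease, because `φ x` lies between `x` and `x₀`. -/
theorem strictMonoOn_of_add_eq_const {G : Type*} [AddCommGroup G] [TopologicalSpace G]
    [IsTopologicalAddGroup G] {D : Set ℝ} {a b : ℝ → G} (ha : IsEmbedding (D.domRestrict a))
    (hb : IsEmbedding (D.domRestrict b)) {φ : ℝ → ℝ} {x₀ r : ℝ} {e : G}
    (hφD : ∀ x ∈ D, φ x ∈ D) (hφ : ∀ x ∈ D, φ x ∈ uIcc x x₀) (he : ∀ x ∈ D, a x + b (φ x) = e)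
    (hr : 0 < r) (hD : Icc (x₀ - r) (x₀ + r) ⊆ D) :
    ContinuousOn φ (Icc (x₀ - r) (x₀ + r)) ∧ StrictMonoOn φ (Icc (x₀ - r) (x₀ + r)) := by
  have hc : ContinuousOn φ D := by
    rw [continuousOn_iff_continuous_domRestrict]
    let F : D → D := fun x => ⟨φ x, hφD x x.2⟩
    have hF : Continuous F := by
      rw [hb.continuous_iff]
      have : D.domRestrict b ∘ F = fun x => e - D.domRestrict a x :=
        funext fun x => by
          simp only [F, Function.comp_apply, domRestrict_apply]
          rw [← he x x.2]; abel
      rw [this]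
      exact continuous_const.sub ha.continuous
    exact continuous_subtype_val.comp hF
  have hinj : InjOn φ D := fun x hx y hy hxy => by
    have h1 := he x hx
    rw [hxy, ← he y hy, add_left_inj] at h1
    exact injOn_iff_injective.2 ha.injective hx hy h1
  have hx₀ : x₀ ∈ Icc (x₀ - r) (x₀ + r) := ⟨by linarith, by linarith⟩
  have hx₁ : x₀ + r ∈ Icc (x₀ - r) (x₀ + r) := ⟨by linarith, le_rfl⟩
  refine ⟨hc.mono hD, ?_⟩
  rcases (hc.mono hD).strictMonoOn_of_injOn_Icc' (by linarith) (hinj.mono hD) with h | h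
  · exact h
  · have h1 := h hx₀ hx₁ (by linarith)
    have h2 := hφ _ (hD hx₁)
    have h3 := hφ _ (hD hx₀)
    rw [uIcc_self, mem_singleton_iff] at h3
    rw [uIcc_of_ge (by linarith)] at h2
    linarith [h2.1]

/-- Dyadic scales on the three curves, compatible with collinearity, around an interior point. -/
theorem IsStandardSystem.exists_scales {D : Set ℝ} {α β γ : ℝ → ℝ}
    (h : IsStandardSystem D α β γ) {G : Type*} [AddCommGroup G] [TopologicalSpace G]
    [IsTopologicalAddGroup G] {a b c : ℝ → G} (hG : CollinearityCoords D α β γ a b c)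
    {x₀ : ℝ} (hx₀ : D ∈ 𝓝 x₀) :
    ∃ X Y Z, IsDyadicScale x₀ X ∧ IsDyadicScale x₀ Y ∧ IsDyadicScale x₀ Z ∧
      (∀ n k, |k| ≤ 2 ^ n → X n k ∈ D ∧ Y n k ∈ D ∧ Z n k ∈ D) ∧
      ∀ n i j k, |i| ≤ 2 ^ n → |j| ≤ 2 ^ n → |k| ≤ 2 ^ n → i + k = j →
        det3 (X n i, α (X n i)) (Y n j, β (Y n j)) (Z n k, γ (Z n k)) = 0 := by
  obtain ⟨r, hr, hD⟩ := Metric.nhds_basis_closedBall.mem_iff.1 hx₀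
  rw [Real.closedBall_eq_Icc] at hD
  have hx₀D : x₀ ∈ D := mem_of_mem_nhds hx₀
  have exφ : ∀ x, ∃ y, x ∈ D → y ∈ uIcc x x₀ ∧ det3 (x, α x) (y, β y) (x₀, γ x₀) = 0 := fun x => by
    by_cases hx : x ∈ D
    · obtain ⟨y, hy⟩ := h.exists_between hx hx₀D
      exact ⟨y, fun _ => hy⟩
    · exact ⟨0, fun h => absurd h hx⟩
  have exψ : ∀ z, ∃ y, z ∈ D → y ∈ uIcc z x₀ ∧ det3 (x₀, α x₀) (y, β y) (z, γ z) = 0 := fun z => by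
    by_cases hz : z ∈ D
    · obtain ⟨y, hy⟩ := h.exists_between hx₀D hz
      exact ⟨y, fun _ => by rwa [uIcc_comm]⟩
    · exact ⟨0, fun h => absurd h hz⟩
  choose φ hφ using exφ
  choose ψ hψ using exψ
  have hφD : ∀ x ∈ D, φ x ∈ D := fun x hx => h.ordConnected.uIcc_subset hx hx₀D (hφ x hx).1
  have hψD : ∀ x ∈ D, ψ x ∈ D := fun x hx => h.ordConnected.uIcc_subset hx hx₀D (hψ x hx).1
  have eφ : ∀ x ∈ D, a x + b (φ x) + c x₀ = 0 := fun x hx =>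
    (hG.iff x hx _ (hφD x hx) x₀ hx₀D).1 (hφ x hx).2
  have eψ : ∀ z ∈ D, a x₀ + b (ψ z) + c z = 0 := fun z hz =>
    (hG.iff x₀ hx₀D _ (hψD z hz) z hz).1 (hψ z hz).2
  have φ0 : φ x₀ = x₀ := by simpa using (hφ x₀ hx₀D).1
  have ψ0 : ψ x₀ = x₀ := by simpa using (hψ x₀ hx₀D).1
  have e0 : a x₀ + b x₀ + c x₀ = 0 := by simpa only [φ0] using eφ x₀ hx₀D
  obtain ⟨φc, φm⟩ := strictMonoOn_of_add_eq_const hG.emb_a hG.emb_b hφD (fun x hx => (hφ x hx).1)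
    (e := -c x₀) (fun x hx => eq_neg_of_add_eq_zero_left (eφ x hx)) hr hD
  obtain ⟨ψc, ψm⟩ := strictMonoOn_of_add_eq_const hG.emb_c hG.emb_b hψD (fun x hx => (hψ x hx).1)
    (e := -a x₀) (fun x hx => eq_neg_of_add_eq_zero_left (by rw [← eψ x hx]; abel)) hr hD
  have m0 : x₀ ∈ Icc (x₀ - r) (x₀ + r) := ⟨by linarith, by linarith⟩
  have m1 : x₀ + r ∈ Icc (x₀ - r) (x₀ + r) := ⟨by linarith, le_rfl⟩
  have m2 : x₀ - r ∈ Icc (x₀ - r) (x₀ + r) := ⟨le_rfl, by linarith⟩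
  obtain ⟨ρ, hρ, ρr, ρ1, ρ2, ρ3, ρ4⟩ : ∃ ρ > 0, ρ ≤ r ∧ φ (x₀ - r) ≤ x₀ - ρ ∧
      x₀ + ρ ≤ φ (x₀ + r) ∧ ψ (x₀ - r) ≤ x₀ - ρ ∧ x₀ + ρ ≤ ψ (x₀ + r) := by
    have p1 := φm m0 m1 (by linarith)
    have p2 := φm m2 m0 (by linarith)
    have p3 := ψm m0 m1 (by linarith)
    have p4 := ψm m2 m0 (by linarith)
    rw [φ0] at p1 p2
    rw [ψ0] at p3 p4
    have hfin : ∀ᶠ ρ in 𝓝[>] (0 : ℝ), ρ < r ∧ ρ < x₀ - φ (x₀ - r) ∧ ρ < φ (x₀ + r) - x₀ ∧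
        ρ < x₀ - ψ (x₀ - r) ∧ ρ < ψ (x₀ + r) - x₀ := by
      refine nhdsWithin_le_nhds ?_
      exact (eventually_lt_nhds hr).and <| (eventually_lt_nhds (by linarith)).and <|
        (eventually_lt_nhds (by linarith)).and <| (eventually_lt_nhds (by linarith)).and <|
        eventually_lt_nhds (by linarith)
    obtain ⟨ρ, ⟨q1, q2, q3, q4, q5⟩, hρ⟩ := (hfin.and self_mem_nhdsWithin).exists
    exact ⟨ρ, hρ, q1.le, by linarith, by linarith, by linarith, by linarith⟩
  -- The sign is chosen so that `B s = a x - a x₀` when `φ x = x₀ + s`, and `B t = c z - c x₀` when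
  -- `ψ z = x₀ + t`. Collinearity then reads `B u = B s + B t`, with `x₀ + u` the abscissa on `β`.
  set B : ℝ → G := fun s => b x₀ - b (x₀ + s) with hBdef
  have hsh : ∀ s ∈ Icc (-r) r, x₀ + s ∈ D := fun s hs =>
    hD ⟨by linarith [hs.1], by linarith [hs.2]⟩
  have hB : IsEmbedding ((Icc (-r) r).domRestrict B) := by
    let q : Icc (-r) r → D := fun s => ⟨x₀ + s.1, hsh s.1 s.2⟩
    have hq : IsEmbedding q := by
      refine IsEmbedding.of_comp (by fun_prop) continuous_subtype_val ?_
      exact (Homeomorph.addLeft x₀).isEmbedding.comp IsEmbedding.subtypeVal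
    exact (Homeomorph.subLeft (b x₀)).isEmbedding.comp (hG.emb_b.comp hq)
  have Bφ : ∀ x ∈ D, ∀ s, φ x = x₀ + s → B s = b x₀ + a x + c x₀ := fun x hx s hs => by
    have := eφ x hx
    simp only [hBdef, ← hs]
    rw [sub_eq_iff_eq_add, ← sub_eq_zero, ← neg_eq_zero, ← this]; abel
  have Bψ : ∀ z ∈ D, ∀ s, ψ z = x₀ + s → B s = b x₀ + a x₀ + c z := fun z hz s hs => by
    have := eψ z hz
    simp only [hBdef, ← hs]
    rw [sub_eq_iff_eq_add, ← sub_eq_zero, ← neg_eq_zero, ← this]; abel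
  have hsum : ∀ x ∈ D, ∀ y ∈ D, ∀ z ∈ D, ∀ s t u, φ x = x₀ + s → ψ z = x₀ + t → y = x₀ + u →
      (a x + b y + c z = 0 ↔ B u = B s + B t) := by
    intro x hx y hy z hz s t u hs ht hu
    have key : a x + b y + c z = -(B u - (B s + B t)) := by
      rw [Bφ x hx s hs, Bψ z hz t ht, ← add_zero (a x + b y + c z), ← e0]
      simp only [hBdef, hu]
      abel
    rw [key, neg_eq_zero, sub_eq_zero]
  obtain ⟨m, hm⟩ := exists_isLocalAdd hρ ρr hB (by simp [hBdef]) (by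
    intro s hs t ht
    obtain ⟨x, hx, hxs⟩ := intermediate_value_Icc (by linarith) φc
      (show x₀ + s ∈ Icc _ _ from ⟨by linarith [hs.1], by linarith [hs.2]⟩)
    obtain ⟨z, hz, hzt⟩ := intermediate_value_Icc (by linarith) ψc
      (show x₀ + t ∈ Icc _ _ from ⟨by linarith [ht.1], by linarith [ht.2]⟩)
    obtain ⟨y, hy, hy0⟩ := h.exists_between (hD hx) (hD hz)
    have hyI : y ∈ Icc (x₀ - r) (x₀ + r) := ordConnected_Icc.uIcc_subset hx hz hy
    refine ⟨y - x₀, ⟨by linarith [hyI.1], by linarith [hyI.2]⟩, ?_⟩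
    rw [← hsum x (hD hx) y (hD hyI) z (hD hz) s t (y - x₀) hxs hzt (by ring)]
    exact (hG.iff x (hD hx) y (hD hyI) z (hD hz)).1 hy0)
  obtain ⟨g, H, hH, hHB⟩ := hm.exists_dyadicScale
  have hHρ : ∀ n k, |k| ≤ 2 ^ n → H n k ∈ Icc (-ρ) ρ := fun n k hk => (hHB n k hk).1
  obtain ⟨X, hX, hX'⟩ := hH.exists_transport hr hHρ φc φm φ0 ρ1 ρ2
  obtain ⟨Z, hZ, hZ'⟩ := hH.exists_transport hr hHρ ψc ψm ψ0 ρ3 ρ4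
  -- The middle curve carries the local group itself, so its scale is `H` merely shifted by `x₀`.
  obtain ⟨Y, hY, hY'⟩ := hH.exists_transport hr hHρ (φ := id) continuousOn_id
    (strictMono_id.strictMonoOn _) rfl (show x₀ - r ≤ x₀ - ρ by linarith)
    (show x₀ + ρ ≤ x₀ + r by linarith)
  have hmem : ∀ n k, |k| ≤ 2 ^ n → X n k ∈ D ∧ Y n k ∈ D ∧ Z n k ∈ D := fun n k hk =>
    ⟨hD (hX' n k hk).1, hD (hY' n k hk).1, hD (hZ' n k hk).1⟩
  refine ⟨X, Y, Z, hX, hY, hZ, hmem, fun n i j k hi hj hk hs => ?_⟩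
  rw [hG.iff _ (hmem n i hi).1 _ (hmem n j hj).2.1 _ (hmem n k hk).2.2,
    hsum _ (hmem n i hi).1 _ (hmem n j hj).2.1 _ (hmem n k hk).2.2 _ _ _
      (hX' n i hi).2 (hZ' n k hk).2 (hY' n j hj).2,
    (hHB n i hi).2, (hHB n j hj).2, (hHB n k hk).2, ← hs, add_zsmul]

/-! ### Cubic polynomials as a space of dimension ten. -/

theorem IsPolyLE.continuous {n : ℕ} {f : ℝ × ℝ → ℝ} (hf : IsPolyLE n f) : Continuous f := by
  induction n generalizing f with
  | zero =>
    obtain ⟨c, hc⟩ := hf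
    rw [show f = fun _ => c from funext hc]
    exact continuous_const
  | succ n ih =>
    obtain ⟨c, g, h, hg, hh, hf⟩ := hf
    rw [funext hf]
    have := ih hg
    have := ih hh
    fun_prop

theorem IsPolyLE.exists_mvPolynomial {n : ℕ} {f : ℝ × ℝ → ℝ} (hf : IsPolyLE n f) :
    ∃ p : MvPolynomial (Fin 2) ℝ, p.totalDegree ≤ n ∧
      ∀ P, MvPolynomial.eval ![P.1, P.2] p = f P := by
  induction n generalizing f with
  | zero =>
    obtain ⟨c, hc⟩ := hf
    exact ⟨MvPolynomial.C c, by simp, fun P => by simp [hc]⟩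
  | succ n ih =>
    obtain ⟨c, g, h, hg, hh, hf⟩ := hf
    obtain ⟨p, hp, hp'⟩ := ih hg
    obtain ⟨q, hq, hq'⟩ := ih hh
    refine ⟨MvPolynomial.C c + MvPolynomial.X 0 * p + MvPolynomial.X 1 * q, ?_, fun P => ?_⟩
    · have h1 := MvPolynomial.totalDegree_mul (MvPolynomial.X 0) p
      have h2 := MvPolynomial.totalDegree_mul (MvPolynomial.X 1) q
      rw [MvPolynomial.totalDegree_X] at h1 h2
      refine (MvPolynomial.totalDegree_add _ _).trans (max_le ?_ (by omega))
      exact (MvPolynomial.totalDegree_add _ _).trans (max_le (by simp) (by omega))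
    · simp [hf, hp', hq']

theorem IsPolyLE.exists_isCubicCurve {f : ℝ × ℝ → ℝ} (hf : IsPolyLE 3 f) (h0 : ∃ P, f P ≠ 0) :
    ∃ C, IsCubicCurve C ∧ {P | f P = 0} ⊆ C := by
  obtain ⟨p, hp, hpf⟩ := hf.exists_mvPolynomial
  obtain ⟨P, hP⟩ := h0
  have hp0 : p ≠ 0 := by
    rintro rfl
    exact hP (by rw [← hpf, map_zero])
  -- A power of the first variable raises the degree to exactly 3 and only enlarges the zero set.
  refine ⟨_, ⟨p * MvPolynomial.X 0 ^ (3 - p.totalDegree), ?_, rfl⟩, fun Q hQ => ?_⟩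
  · rw [MvPolynomial.totalDegree_mul_of_isDomain hp0 (pow_ne_zero _ (MvPolynomial.X_ne_zero _)),
      MvPolynomial.totalDegree_X_pow]
    omega
  · simp only [mem_ofPred_eq] at hQ ⊢
    rw [map_mul, hpf, hQ, zero_mul]

/-- The values at a point of the ten monomials of degree at most three. -/
def cubicMonomials (P : ℝ × ℝ) : Fin 10 → ℝ :=
  ![1, P.1, P.2, P.1 ^ 2, P.1 * P.2, P.2 ^ 2, P.1 ^ 3, P.1 ^ 2 * P.2, P.1 * P.2 ^ 2, P.2 ^ 3]

/-- The value at `P` of the cubic with given coefficients. -/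
noncomputable def cubicEval (P : ℝ × ℝ) : (Fin 10 → ℝ) →ₗ[ℝ] ℝ :=
  Fintype.linearCombination ℝ (cubicMonomials P)

theorem cubicEval_apply (P : ℝ × ℝ) (c : Fin 10 → ℝ) :
    cubicEval P c = c 0 + c 1 * P.1 + c 2 * P.2 + c 3 * P.1 ^ 2 + c 4 * (P.1 * P.2) + c 5 * P.2 ^ 2
      + c 6 * P.1 ^ 3 + c 7 * (P.1 ^ 2 * P.2) + c 8 * (P.1 * P.2 ^ 2) + c 9 * P.2 ^ 3 := by
  simp [cubicEval, Fintype.linearCombination_apply, Fin.sum_univ_succ, cubicMonomials]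
  ring

theorem isPolyLE_cubicEval (c : Fin 10 → ℝ) : IsPolyLE 3 (fun P => cubicEval P c) := by
  have k : ∀ (n : ℕ) (a : ℝ), IsPolyLE n fun _ => a := IsPolyLE.const
  refine ⟨c 0, fun P => c 1 + P.1 * (c 3 + P.1 * c 6 + P.2 * c 7) + P.2 * (c 4 + P.1 * 0 + P.2 * c 8),
    fun P => c 2 + P.1 * 0 + P.2 * (c 5 + P.1 * 0 + P.2 * c 9),
    ⟨_, _, _, ⟨_, _, _, k 0 _, k 0 _, fun _ => rfl⟩, ⟨_, _, _, k 0 _, k 0 _, fun _ => rfl⟩,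
      fun _ => rfl⟩,
    ⟨_, _, _, k 1 0, ⟨_, _, _, k 0 _, k 0 _, fun _ => rfl⟩, fun _ => rfl⟩, fun P => ?_⟩
  simp only [cubicEval_apply]
  ring

/-- The ten evaluation points below impose independent conditions on cubics. -/
theorem exists_cubicEval_ne_zero {c : Fin 10 → ℝ} (hc : c ≠ 0) : ∃ P, cubicEval P c ≠ 0 := by
  by_contra! h
  simp only [cubicEval_apply] at h
  have e0 := h (0, 0)
  have e1 := h (1, 0)
  have e2 := h (-1, 0)
  have e3 := h (2, 0)
  have e4 := h (0, 1)
  have e5 := h (0, -1)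
  have e6 := h (0, 2)
  have e7 := h (1, 1)
  have e8 := h (1, -1)
  have e9 := h (-1, 1)
  norm_num at e0 e1 e2 e3 e4 e5 e6 e7 e8 e9
  refine hc (funext fun i => ?_)
  fin_cases i <;> simp <;> linarith

/-- The three curves meet the zero set of `f` over the abscissa `x`. -/
def VanishesAt (f : ℝ × ℝ → ℝ) (α β γ : ℝ → ℝ) (x : ℝ) : Prop :=
  f (x, α x) = 0 ∧ f (x, β x) = 0 ∧ f (x, γ x) = 0

/-! ### A cubic containing the curves locally, and its spreading across a point. -/

theorem IsDyadicScale.eventually_eq_zero {x₀ : ℝ} {X : ℕ → ℤ → ℝ} (hX : IsDyadicScale x₀ X)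
    {D : Set ℝ} (hD : D ∈ 𝓝 x₀) {h : ℝ → ℝ} (hc : ContinuousOn h D) {N : ℕ}
    (hz : ∀ n ≥ N, ∀ k, 2 * |k| ≤ 2 ^ n → h (X n k) = 0) : ∀ᶠ x in 𝓝 x₀, h x = 0 := by
  obtain ⟨η, hη, hd⟩ := hX.dense
  filter_upwards [Ioo_mem_nhds (by linarith : x₀ - η < x₀) (by linarith : x₀ < x₀ + η),
    eventually_mem_nhds_iff.2 hD] with x hx hxD
  by_contra hne
  have hev : ∀ᶠ y in 𝓝 x, h y ≠ 0 ∧ y ∈ Ioo (x₀ - η) (x₀ + η) :=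
    ((hc.continuousAt hxD).eventually_ne hne).and (Ioo_mem_nhds hx.1 hx.2)
  obtain ⟨ε, hε, hball⟩ := Metric.eventually_nhds_iff_ball.1 hev
  rw [Real.ball_eq_Ioo] at hball
  have h1 := (hball (x - ε / 2) ⟨by linarith, by linarith⟩).2
  have h2 := (hball (x + ε / 2) ⟨by linarith, by linarith⟩).2
  obtain ⟨M, hM⟩ := hd (x - ε / 2) (x + ε / 2) h1.1 (by linarith) h2.2
  obtain ⟨k, hk, hk1, hk2⟩ := hM (max M N) (le_max_left _ _)
  exact (hball _ ⟨by linarith, by linarith⟩).1 (hz _ (le_max_right _ _) k hk)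

section Scales

variable {D : Set ℝ} {α β γ : ℝ → ℝ} {x₀ : ℝ} {X Y Z : ℕ → ℤ → ℝ}

/-- Dyadic scales on the three curves that are compatible with collinearity. -/
structure AreCollinearScales (D : Set ℝ) (α β γ : ℝ → ℝ) (x₀ : ℝ) (X Y Z : ℕ → ℤ → ℝ) :
    Prop where
  scale_X : IsDyadicScale x₀ X
  scale_Y : IsDyadicScale x₀ Y
  scale_Z : IsDyadicScale x₀ Z
  mem : ∀ n k, |k| ≤ 2 ^ n → X n k ∈ D ∧ Y n k ∈ D ∧ Z n k ∈ D
  det_eq : ∀ n i j k, |i| ≤ 2 ^ n → |j| ≤ 2 ^ n → |k| ≤ 2 ^ n → i + k = j →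
    det3 (X n i, α (X n i)) (Y n j, β (Y n j)) (Z n k, γ (Z n k)) = 0

/-- The index on `β` is the sum of the other two, so reversing it gives the symmetric condition of
sum zero. The injectivity conditions hold because a line through a point of one curve meets each
other curve at most once. -/
theorem AreCollinearScales.collinearGrid (hS : AreCollinearScales D α β γ x₀ X Y Z)
    (h : IsStandardSystem D α β γ) (n : ℕ) :
    CollinearGrid (2 ^ n) (fun i => (X n i, α (X n i))) (fun j => (Y n (-j), β (Y n (-j))))
      (fun k => (Z n k, γ (Z n k))) := by
  have hX : ∀ i, |i| ≤ 2 ^ n → X n i ∈ D := fun i hi => (hS.mem n i hi).1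
  have hY : ∀ i, |i| ≤ 2 ^ n → Y n (-i) ∈ D := fun i hi => (hS.mem n (-i) (by rwa [abs_neg])).2.1
  have hZ : ∀ i, |i| ≤ 2 ^ n → Z n i ∈ D := fun i hi => (hS.mem n i hi).2.2
  have gα : ∀ x ∈ D, ((x, α x) : ℝ × ℝ) ∈ D.graphOn α := fun x hx => mem_image_of_mem _ hx
  have gβ : ∀ x ∈ D, ((x, β x) : ℝ × ℝ) ∈ D.graphOn β := fun x hx => mem_image_of_mem _ hx
  have gγ : ∀ x ∈ D, ((x, γ x) : ℝ × ℝ) ∈ D.graphOn γ := fun x hx => mem_image_of_mem _ hx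
  have hdet : ∀ i j k, |i| ≤ 2 ^ n → |j| ≤ 2 ^ n → |k| ≤ 2 ^ n → i + j + k = 0 →
      det3 (X n i, α (X n i)) (Y n (-j), β (Y n (-j))) (Z n k, γ (Z n k)) = 0 :=
    fun i j k hi hj hk hs => hS.det_eq n i (-j) k hi (by rwa [abs_neg]) hk (by omega)
  refine ⟨hdet, fun i j hi _ => h.ne_αβ (hX i hi), fun i j hi _ => h.ne_βγ (hY i hi),
    fun i j _ hj => (h.ne_αγ (hX j hj)).symm, fun i j k i' hi hj hk hi' hs h0 => ?_,
    fun i j k j' hi hj hk hj' hs h0 => ?_, fun i j k k' hi hj hk hk' hs h0 => ?_⟩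
  · have h1 := hdet i j k hi hj hk hs
    rw [det3_rotate] at h0 h1
    have h2 := h.lines_β_α.eq_of_det3 (gβ _ (hY j hj)) (gα _ (hX i' hi')) (gα _ (hX i hi))
      (det3_of_line (h.ne_βγ (hY j hj)) h0 h1).1
    exact (hS.scale_X.mono n).injOn (abs_le.1 hi') (abs_le.1 hi) (Prod.mk.inj h2).1
  · have h1 := hdet i j k hi hj hk hs
    rw [← det3_rotate] at h0 h1
    have h2 := h.lines_γ_β.eq_of_det3 (gγ _ (hZ k hk)) (gβ _ (hY j' hj')) (gβ _ (hY j hj))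
      (det3_of_line (h.ne_αγ (hX i hi)).symm h0 h1).1
    have h3 := (hS.scale_Y.mono n).injOn (abs_le.1 (by rwa [abs_neg] : |-j'| ≤ 2 ^ n))
      (abs_le.1 (by rwa [abs_neg] : |-j| ≤ 2 ^ n)) (Prod.mk.inj h2).1
    omega
  · have h2 := h.lines_α_γ.eq_of_det3 (gα _ (hX i hi)) (gγ _ (hZ k' hk')) (gγ _ (hZ k hk))
      (det3_of_line (h.ne_αβ (hX i hi)) h0 (hdet i j k hi hj hk hs)).1
    exact (hS.scale_Z.mono n).injOn (abs_le.1 hk') (abs_le.1 hk) (Prod.mk.inj h2).1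

open CollinearGrid in
theorem AreCollinearScales.zero_of_window (hS : AreCollinearScales D α β γ x₀ X Y Z)
    (h : IsStandardSystem D α β γ) {f : ℝ × ℝ → ℝ} (hf : IsPolyLE 3 f) {n : ℕ} (hn : 5 ≤ n)
    {s t w : ℤ} (hs : s + t + w = 0) (s8 : |s| ≤ 8) (t8 : |t| ≤ 8) (w8 : |w| ≤ 8)
    (hA : ZeroOn f (fun i => (X n i, α (X n i))) s 3)
    (hB : ZeroOn f (fun j => (Y n (-j), β (Y n (-j)))) t 3)
    (hC : ZeroOn f (fun k => (Z n k, γ (Z n k))) w 3) (k : ℤ) (hk : 2 * |k| ≤ 2 ^ n) :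
    f (X n k, α (X n k)) = 0 ∧ f (Y n k, β (Y n k)) = 0 ∧ f (Z n k, γ (Z n k)) = 0 := by
  have h32 : (32 : ℤ) ≤ 2 ^ n := by
    have := pow_le_pow_right₀ (by norm_num : (1 : ℤ) ≤ 2) hn
    linarith
  -- Centre at most 8 plus final radius `(2 ^ n - 11) + 3` stays within `2 ^ n`. Since `2 ^ n ≥ 32`,
  -- every `k` with `2 * |k| ≤ 2 ^ n` is reached.
  have hm : ((2 ^ n - 11 : ℤ).toNat : ℤ) = 2 ^ n - 11 := Int.toNat_of_nonneg (by omega)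
  obtain ⟨zA, zB, zC⟩ := (hS.collinearGrid h n).zeroOn_of_window hf hs hA hB hC
    (2 ^ n - 11 : ℤ).toNat (by omega) (by omega) (by omega)
  have hb : ∀ u l : ℤ, |u| ≤ 8 → |l| = |k| → |l - u| ≤ ((2 ^ n - 11 : ℤ).toNat : ℤ) + 3 :=
    fun u l hu hl => (abs_sub l u).trans (by rw [hl]; omega)
  refine ⟨zA k (hb _ _ s8 rfl), ?_, zC k (hb _ _ w8 rfl)⟩
  simpa using zB (-k) (hb _ _ t8 (abs_neg k))

theorem AreCollinearScales.eventually_vanishesAt (hS : AreCollinearScales D α β γ x₀ X Y Z)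
    (h : IsStandardSystem D α β γ) (hD : D ∈ 𝓝 x₀) {f : ℝ × ℝ → ℝ} (hf : IsPolyLE 3 f) {N : ℕ}
    (hz : ∀ n ≥ N, ∀ k, 2 * |k| ≤ 2 ^ n →
      f (X n k, α (X n k)) = 0 ∧ f (Y n k, β (Y n k)) = 0 ∧ f (Z n k, γ (Z n k)) = 0) :
    ∀ᶠ x in 𝓝 x₀, VanishesAt f α β γ x := by
  have hc : ∀ δ : ℝ → ℝ, ContinuousOn δ D → ContinuousOn (fun x => f (x, δ x)) D := fun δ hδ =>
    hf.continuous.comp_continuousOn (continuousOn_id.prodMk hδ)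
  exact (hS.scale_X.eventually_eq_zero hD (hc α h.continuousOn_α) fun n hn k hk =>
    (hz n hn k hk).1).and <| (hS.scale_Y.eventually_eq_zero hD (hc β h.continuousOn_β)
      fun n hn k hk => (hz n hn k hk).2.1).and <|
    hS.scale_Z.eventually_eq_zero hD (hc γ h.continuousOn_γ) fun n hn k hk => (hz n hn k hk).2.2

theorem IsDyadicScale.lt_and_lt (hX : IsDyadicScale x₀ X) {n : ℕ} {K : ℕ} (hK : (K : ℤ) ≤ 2 ^ n)
    {k : ℤ} (hk : |k| ≤ K) :
    X n (-K) ≤ X n k ∧ X n k ≤ X n K ∧ (k < 0 → X n k < x₀) ∧ (0 < k → x₀ < X n k) := by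
  have hm := hX.mono n
  have hk' := abs_le.1 hk
  have m : ∀ j : ℤ, |j| ≤ K → j ∈ Icc (-2 ^ n : ℤ) (2 ^ n) := fun j hj => abs_le.1 (hj.trans hK)
  have mk := m k hk
  have m0 : (0 : ℤ) ∈ Icc (-2 ^ n : ℤ) (2 ^ n) := m 0 (by simp)
  rw [← hX.zero n]
  exact ⟨hm.monotoneOn (m _ (by simp)) mk hk'.1, hm.monotoneOn mk (m _ (by simp)) hk'.2,
    fun h => hm mk m0 h, fun h => hm m0 mk h⟩

/-- If a cubic contains the curves on one side of `x₀`, then it contains them near `x₀`. -/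
theorem AreCollinearScales.eventually_of_side (hS : AreCollinearScales D α β γ x₀ X Y Z)
    (h : IsStandardSystem D α β γ) (hD : D ∈ 𝓝 x₀) {f : ℝ × ℝ → ℝ} (hf : IsPolyLE 3 f)
    {δ : ℝ} (hδ : 0 < δ) (hside : (∀ x ∈ Ioo (x₀ - δ) x₀, VanishesAt f α β γ x) ∨
      ∀ x ∈ Ioo x₀ (x₀ + δ), VanishesAt f α β γ x) :
    ∀ᶠ x in 𝓝 x₀, VanishesAt f α β γ x := by
  -- The windows used have centres of absolute value at most 8 and radius 3, so indices up to 11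
  -- must lie within `δ` of `x₀`.
  obtain ⟨N₁, hN₁⟩ := hS.scale_X.small 11 δ hδ
  obtain ⟨N₂, hN₂⟩ := hS.scale_Y.small 11 δ hδ
  obtain ⟨N₃, hN₃⟩ := hS.scale_Z.small 11 δ hδ
  refine hS.eventually_vanishesAt h hD hf (N := max 5 (max N₁ (max N₂ N₃))) fun n hn => ?_
  simp only [ge_iff_le, max_le_iff] at hn
  obtain ⟨n5, n1, n2, n3⟩ := hn
  obtain ⟨hK, x1, x2⟩ := hN₁ n n1
  obtain ⟨-, y1, y2⟩ := hN₂ n n2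
  obtain ⟨-, z1, z2⟩ := hN₃ n n3
  rcases hside with hv | hv
  -- The centres sum to zero, and after the sign reversal on `β` the three windows are `[-7, -1]`,
  -- `[-11, -5]` and `[-7, -1]`: all indices are negative, so all points lie to the left of `x₀`.
  · refine hS.zero_of_window h hf n5 (s := -4) (t := 8) (w := -4) (by norm_num) (by norm_num)
      (by norm_num) (by norm_num) ?_ ?_ ?_ <;> intro i hi <;> rw [abs_le] at hi
    · obtain ⟨h1, h2, h3, -⟩ := hS.scale_X.lt_and_lt hK (k := i)
        (abs_le.2 ⟨by push_cast; omega, by push_cast; omega⟩)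
      exact (hv _ ⟨by linarith, h3 (by omega)⟩).1
    · obtain ⟨h1, h2, h3, -⟩ := hS.scale_Y.lt_and_lt hK (k := -i)
        (abs_le.2 ⟨by push_cast; omega, by push_cast; omega⟩)
      exact (hv _ ⟨by linarith, h3 (by omega)⟩).2.1
    · obtain ⟨h1, h2, h3, -⟩ := hS.scale_Z.lt_and_lt hK (k := i)
        (abs_le.2 ⟨by push_cast; omega, by push_cast; omega⟩)
      exact (hv _ ⟨by linarith, h3 (by omega)⟩).2.2
  · refine hS.zero_of_window h hf n5 (s := 4) (t := -8) (w := 4) (by norm_num) (by norm_num)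
      (by norm_num) (by norm_num) ?_ ?_ ?_ <;> intro i hi <;> rw [abs_le] at hi
    · obtain ⟨h1, h2, -, h3⟩ := hS.scale_X.lt_and_lt hK (k := i)
        (abs_le.2 ⟨by push_cast; omega, by push_cast; omega⟩)
      exact (hv _ ⟨h3 (by omega), by linarith⟩).1
    · obtain ⟨h1, h2, -, h3⟩ := hS.scale_Y.lt_and_lt hK (k := -i)
        (abs_le.2 ⟨by push_cast; omega, by push_cast; omega⟩)
      exact (hv _ ⟨h3 (by omega), by linarith⟩).2.1
    · obtain ⟨h1, h2, -, h3⟩ := hS.scale_Z.lt_and_lt hK (k := i)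
        (abs_le.2 ⟨by push_cast; omega, by push_cast; omega⟩)
      exact (hv _ ⟨h3 (by omega), by linarith⟩).2.2

/-- Some cubic contains the three curves near `x₀`. -/
theorem AreCollinearScales.exists_cubic (hS : AreCollinearScales D α β γ x₀ X Y Z)
    (h : IsStandardSystem D α β γ) (hD : D ∈ 𝓝 x₀) :
    ∃ f, IsPolyLE 3 f ∧ (∃ P, f P ≠ 0) ∧ ∀ᶠ x in 𝓝 x₀, VanishesAt f α β γ x := by
  let S : ℕ → Set (ℝ × ℝ) := fun n => {P | ∃ k : ℤ, 2 * |k| ≤ 2 ^ n ∧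
    (P = (X n k, α (X n k)) ∨ P = (Y n k, β (Y n k)) ∨ P = (Z n k, γ (Z n k)))}
  let V : ℕ → Submodule ℝ (Fin 10 → ℝ) := fun n => ⨅ P ∈ S n, LinearMap.ker (cubicEval P)
  have hV : ∀ n c, c ∈ V n ↔ ∀ P ∈ S n, cubicEval P c = 0 := fun n c => by
    simp only [V, Submodule.mem_iInf, LinearMap.mem_ker]
  have hSmono : ∀ n, S n ⊆ S (n + 1) := by
    rintro n P ⟨k, hk, hP⟩
    have hk' : |k| ≤ 2 ^ n := by linarith [abs_nonneg k]
    refine ⟨2 * k, ?_, ?_⟩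
    · rw [abs_mul, pow_succ]; simp only [Nat.abs_ofNat]; linarith
    · rwa [hS.scale_X.nested n k hk', hS.scale_Y.nested n k hk', hS.scale_Z.nested n k hk']
  have hanti : Antitone V := antitone_nat_of_succ_le fun n c hc =>
    (hV n c).2 fun P hP => (hV _ c).1 hc P (hSmono n hP)
  have hne : ∀ n ≥ 5, V n ≠ ⊥ := by
    intro n hn
    -- Nine linear conditions on ten coefficients leave a nonzero cubic, and these nine points are
    -- the ones from which the central window can be deduced.
    let pts : Fin 9 → ℝ × ℝ := ![(X n (-2), α (X n (-2))), (X n (-1), α (X n (-1))),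
      (X n 0, α (X n 0)), (Y n (-(-1)), β (Y n (-(-1)))), (Y n (-0), β (Y n (-0))),
      (Z n (-1), γ (Z n (-1))), (Z n 0, γ (Z n 0)), (Z n 1, γ (Z n 1)), (Z n 2, γ (Z n 2))]
    have hker := LinearMap.ker_ne_bot_of_finrank_lt (f := LinearMap.pi fun i => cubicEval (pts i))
      (by simp)
    obtain ⟨c, hc, hc0⟩ := (Submodule.ne_bot_iff _).1 hker
    refine (Submodule.ne_bot_iff _).2 ⟨c, (hV n c).2 ?_, hc0⟩
    have hpt : ∀ i, cubicEval (pts i) c = 0 := fun i => congrFun (LinearMap.mem_ker.1 hc) i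
    have h8 : (3 : ℤ) ≤ 2 ^ n := by
      have := pow_le_pow_right₀ (by norm_num : (1 : ℤ) ≤ 2) hn
      linarith
    obtain ⟨zA, zB, zC⟩ := (hS.collinearGrid h n).zeroOn_three (isPolyLE_cubicEval c) h8
      (fun i hi => by
        obtain ⟨i1, i2⟩ := hi
        interval_cases i
        exacts [hpt 0, hpt 1, hpt 2])
      (fun i hi => by
        obtain ⟨i1, i2⟩ := hi
        interval_cases i
        exacts [hpt 3, hpt 4])
      (fun i hi => by
        obtain ⟨i1, i2⟩ := hi
        interval_cases i
        exacts [hpt 5, hpt 6, hpt 7, hpt 8])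
    rintro P ⟨k, hk, hP⟩
    obtain ⟨k1, k2, k3⟩ := hS.zero_of_window h (isPolyLE_cubicEval c) hn (by norm_num)
      (by norm_num) (by norm_num) (by norm_num) zA zB zC k hk
    rcases hP with rfl | rfl | rfl
    exacts [k1, k2, k3]
  -- A decreasing chain of subspaces of a finite-dimensional space is eventually constant, so a
  -- nonzero member of `V M` vanishes on the grids of all levels.
  obtain ⟨M, hM⟩ := IsArtinian.monotone_stabilizes
    (⟨fun n => OrderDual.toDual (V n), fun _ _ hmn => hanti hmn⟩ :
      ℕ →o (Submodule ℝ (Fin 10 → ℝ))ᵒᵈ)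
  have hM' : ∀ n ≥ M, V M = V n := hM
  have hL : V M ≠ ⊥ := by
    rw [hM' (max M 5) (le_max_left _ _)]
    exact hne _ (le_max_right _ _)
  obtain ⟨c, hc, hc0⟩ := (Submodule.ne_bot_iff _).1 hL
  refine ⟨_, isPolyLE_cubicEval c, exists_cubicEval_ne_zero hc0,
    hS.eventually_vanishesAt h hD (isPolyLE_cubicEval c) (N := M) fun n hn k hk => ?_⟩
  rw [hM' n hn, hV] at hc
  exact ⟨hc _ ⟨k, hk, Or.inl rfl⟩, hc _ ⟨k, hk, Or.inr (Or.inl rfl)⟩,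
    hc _ ⟨k, hk, Or.inr (Or.inr rfl)⟩⟩

end Scales

/-! ### Continuation along the interval and conclusion. -/

/-- A property that holds near `0` and that spreads from one side of a point to a neighbourhood
holds on every open interval around `0`. -/
theorem forall_of_spread {p : ℝ → Prop} {U : Set ℝ} (hU : U.OrdConnected) (h0 : (0 : ℝ) ∈ U)
    (hp0 : ∀ᶠ x in 𝓝 0, p x)
    (hs : ∀ x ∈ U, ∀ δ > 0, ((∀ y ∈ Ioo (x - δ) x, p y) ∨ ∀ y ∈ Ioo x (x + δ), p y) →
      ∀ᶠ y in 𝓝 x, p y) :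
    ∀ x ∈ U, p x := by
  have hext : ∀ x, (∀ᶠ y in 𝓝 x, p y) → ∃ ε > 0, ∀ y ∈ Ioo (x - ε) (x + ε), p y := fun x hx => by
    obtain ⟨ε, hε, hb⟩ := Metric.eventually_nhds_iff_ball.1 hx
    rw [Real.ball_eq_Ioo] at hb
    exact ⟨ε, hε, hb⟩
  intro x hx
  rcases le_total 0 x with h | h
  · have hsub : Icc 0 x ⊆ U := hU.out h0 hx
    let s : Set ℝ := {t | ∀ y ∈ Ico 0 t, p y}
    have hcl : IsClosed s := by
      refine isClosed_of_closure_subset fun t ht y hy => ?_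
      obtain ⟨t', ht', hd⟩ := Metric.mem_closure_iff.1 ht (t - y) (by linarith [hy.2])
      rw [Real.dist_eq] at hd
      exact ht' y ⟨hy.1, by linarith [(abs_lt.1 hd).2]⟩
    have hev : ∀ t ∈ s ∩ Icc 0 x, ∀ᶠ y in 𝓝 t, p y := by
      rintro t ⟨ht, ht0⟩
      -- At the starting point the condition defining `s` is empty, so the hypothesis near `0` takes
      -- over there.
      rcases ht0.1.eq_or_lt with rfl | hpos
      · exact hp0
      · exact hs t (hsub ht0) t hpos (Or.inl fun y hy => ht y ⟨by linarith [hy.1], hy.2⟩)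
    have hall := IsClosed.Icc_subset_of_forall_exists_gt (hcl.inter isClosed_Icc)
      (fun y hy => absurd hy.2 (not_lt.2 hy.1)) (fun t ht y hy => by
        obtain ⟨ε, hε, hb⟩ := hext t (hev t ⟨ht.1, Ico_subset_Icc_self ht.2⟩)
        have hy' : t < y := hy
        refine ⟨min y (t + ε), fun z hz => ?_, lt_min hy' (by linarith), min_le_left _ _⟩
        rcases lt_or_ge z t with h | h
        · exact ht.1 z ⟨hz.1, h⟩
        · exact hb z ⟨by linarith, hz.2.trans_le (min_le_right _ _)⟩)
    exact (hev x ⟨hall ⟨h, le_rfl⟩, h, le_rfl⟩).self_of_nhds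
  · have hsub : Icc x 0 ⊆ U := hU.out hx h0
    let s : Set ℝ := {t | ∀ y ∈ Ioc t 0, p y}
    have hcl : IsClosed s := by
      refine isClosed_of_closure_subset fun t ht y hy => ?_
      obtain ⟨t', ht', hd⟩ := Metric.mem_closure_iff.1 ht (y - t) (by linarith [hy.1])
      rw [Real.dist_eq] at hd
      exact ht' y ⟨by linarith [(abs_lt.1 hd).1], hy.2⟩
    have hev : ∀ t ∈ s ∩ Icc x 0, ∀ᶠ y in 𝓝 t, p y := by
      rintro t ⟨ht, ht0⟩
      rcases ht0.2.eq_or_lt with rfl | hneg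
      · exact hp0
      · exact hs t (hsub ht0) (-t) (by linarith)
          (Or.inr fun y hy => ht y ⟨hy.1, by linarith [hy.2]⟩)
    have hall := IsClosed.Icc_subset_of_forall_exists_lt (hcl.inter isClosed_Icc)
      (fun y hy => absurd hy.1 (not_lt.2 hy.2)) (fun t ht y hy => by
        obtain ⟨ε, hε, hb⟩ := hext t (hev t ⟨ht.1, Ioc_subset_Icc_self ht.2⟩)
        have hy' : y < t := hy
        refine ⟨max y (t - ε), fun z hz => ?_, le_max_left _ _, max_lt hy' (by linarith)⟩
        rcases lt_or_ge t z with h | h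
        · exact ht.1 z ⟨h, hz.2⟩
        · exact hb z ⟨(le_max_right _ _).trans_lt hz.1, by linarith⟩)
    exact (hev x ⟨hall ⟨le_rfl, h⟩, le_rfl, h⟩).self_of_nhds

theorem mainTheorem4 {G : Type*} [AddCommGroup G] [TopologicalSpace G]
    [IsTopologicalAddGroup G] (D : Set ℝ) (α β γ : ℝ → ℝ)
    (hsys : IsStandardSystem D α β γ)
    (hG : CollinearityDescribedBy (D.graphOn α) (D.graphOn β) (D.graphOn γ) G) :
    ∃ C : Set (ℝ × ℝ), IsCubicCurve C ∧
      D.graphOn α ∪ D.graphOn β ∪ D.graphOn γ ⊆ C := by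
  obtain ⟨a, b, c, habc⟩ := hsys.exists_coords hG
  have hscales : ∀ x₀, D ∈ 𝓝 x₀ → ∃ X Y Z, AreCollinearScales D α β γ x₀ X Y Z := fun x₀ hx₀ => by
    obtain ⟨X, Y, Z, hX, hY, hZ, hmem, hdet⟩ := hsys.exists_scales habc hx₀
    exact ⟨X, Y, Z, hX, hY, hZ, hmem, hdet⟩
  obtain ⟨X, Y, Z, hS⟩ := hscales 0 hsys.mem_nhds
  obtain ⟨f, hf, hf0, hnear⟩ := hS.exists_cubic hsys hsys.mem_nhds
  have h0 : (0 : ℝ) ∈ interior D := mem_interior_iff_mem_nhds.2 hsys.mem_nhds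
  have hint : ∀ x ∈ interior D, VanishesAt f α β γ x :=
    forall_of_spread hsys.ordConnected.interior h0 hnear fun x hx δ hδ hside => by
      have hxD := mem_interior_iff_mem_nhds.1 hx
      obtain ⟨X, Y, Z, hS⟩ := hscales x hxD
      exact hS.eventually_of_side hsys hxD hf hδ hside
  -- Endpoints belonging to `D` have no two-sided neighbourhood in `D`; they are limits of interior
  -- points, where the cubic already vanishes.
  have hcl : D ⊆ closure (interior D) := by
    rw [(hsys.ordConnected.convex : Convex ℝ D).closure_interior_eq_closure_of_nonempty_interior
      ⟨0, h0⟩]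
    exact subset_closure
  have hext : ∀ δ : ℝ → ℝ, ContinuousOn δ D → (∀ x ∈ interior D, f (x, δ x) = 0) →
      D.graphOn δ ⊆ {P | f P = 0} := by
    rintro δ hδ hz _ ⟨x, hx, rfl⟩
    exact EqOn.of_subset_closure (g := fun _ => (0 : ℝ)) hz
      (hf.continuous.comp_continuousOn (continuousOn_id.prodMk hδ)) continuousOn_const
      interior_subset hcl hx
  obtain ⟨C, hC, hfC⟩ := hf.exists_isCubicCurve hf0
  refine ⟨C, hC, Subset.trans ?_ hfC⟩
  exact union_subset (union_subset (hext α hsys.continuousOn_α fun x hx => (hint x hx).1)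
    (hext β hsys.continuousOn_β fun x hx => (hint x hx).2.1))
    (hext γ hsys.continuousOn_γ fun x hx => (hint x hx).2.2)
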